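/- **Setting.** Let $N\ge 1$, $p>1$, let $E\subset\mathbb R^N$ be bounded and open, and let $f:E\times\mathbb R^{N+1}\to\mathbb R$ be a Carathéodory function with $C_o|\xi|^p\le f(x,s,\xi)\le C_1|\xi|^p$ for a.e. $x\in E$ and all $(s,\xi)\in\mathbb R\times\mathbb R^{N}$, where $0<C_o\le C_1$ are constants. For measurable $A\subset E$ put $J(v;A)=\int_A f(x,v,Dv)\,dx$ (so that $J(v)=J(v;E)$). Let $Q\ge1$ and let $F\subset\mathbb R^N$ be closed. A function $u\in W^{1,p}_{\rm loc}(\mathbb R^N)$ is a *$Q$-subminimum for $J$ in $F$* if $$J(u;E\cap\operatorname{supp}\psi)\le Q\,J(u-\psi;E\cap\operatorname{supp}\psi)$$ for all non-negative $\psi\in W^{1,p}_{\rm loc}(\mathbb R^N)$ with $\operatorname{supp}\psi\subset F$. For an open set $U$, we say that $u=0$ on $U\cap\partial E$ if $\eta u\in W^{1,p}_0(E)$ for every $\eta\in C_c^\infty(U)$. Here $W^{1,p}_0(\Omega)$ is the closure of $C_c^\infty(\Omega)$ in $W^{1,p}(\Omega)$. **Proposition 2.1.** There is a constant $\gamma_o>0$,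 depending only on $N$, $p$, $Q$ and the ratio $C_1/C_o$, with the following property. Let $y\in\partial E$ and $\rho>0$, and let $u$ be a $Q$-subminimum for $J$ in $\bar B_\rho(y)\cap\bar E$ such that $u\ge0$ a.e. in $B_\rho(y)\cap E$ and $u=0$ on $B_\rho(y)\cap\partial E$. Then $$\int_{B_\rho(y)\cap E}|Du|^p|\varphi|^p\,dx\le\gamma_o\int_{B_\rho(y)\cap E}u^p|D\varphi|^p\,dx$$ for all non-negative $\varphi\in W^{1,p}_0(B_\rho(y))$, where the right-hand side may be $+\infty$. The function $\varphi$ need not vanish on $B_\rho(y)\cap\partial E$. -/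

import Mathlib

open MeasureTheory Filter Topology
open scoped ContDiff ENNReal

namespace QMin

/-- `ℝ^N` with its Euclidean norm. -/
abbrev Rn (N : ℕ) : Type := EuclideanSpace ℝ (Fin N)

/-- `η ∈ C_c^∞(Ω)`. -/
def IsTestFunction {N : ℕ} (Ω : Set (Rn N)) (η : Rn N → ℝ) : Prop :=
  ContDiff ℝ ∞ η ∧ HasCompactSupport η ∧ tsupport η ⊆ Ω

/-- `g` is the weak gradient of `u` in the open set `Ω`: both are locally integrable in `Ω` and
`∫ u Dη dx = - ∫ η g dx` for all `η ∈ C_c^∞(Ω)`. Values outside `Ω` play no role. -/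
def HasWeakGradient {N : ℕ} (Ω : Set (Rn N)) (u : Rn N → ℝ) (g : Rn N → Rn N) : Prop :=
  LocallyIntegrableOn u Ω ∧ LocallyIntegrableOn g Ω ∧
    ∀ η : Rn N → ℝ, IsTestFunction Ω η →
      ∫ x, u x • gradient η x = -∫ x, η x • g x

/-- `u ∈ W^{1,p}(Ω)`, with weak gradient `g`. -/
def MemW1p {N : ℕ} (Ω : Set (Rn N)) (p : ℝ) (u : Rn N → ℝ) (g : Rn N → Rn N) : Prop :=
  HasWeakGradient Ω u g ∧
    MemLp u (ENNReal.ofReal p) (volume.restrict Ω) ∧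
    MemLp g (ENNReal.ofReal p) (volume.restrict Ω)

/-- `u ∈ W^{1,p}_loc(ℝ^N)`, with weak gradient `g`. -/
def MemW1pLoc {N : ℕ} (p : ℝ) (u : Rn N → ℝ) (g : Rn N → Rn N) : Prop :=
  HasWeakGradient Set.univ u g ∧
    ∀ K : Set (Rn N), IsCompact K →
      MemLp u (ENNReal.ofReal p) (volume.restrict K) ∧
      MemLp g (ENNReal.ofReal p) (volume.restrict K)

/-- `u ∈ W^{1,p}_0(Ω)`, with weak gradient `g`: `u` is in the closure of `C_c^∞(Ω)` in
`W^{1,p}(Ω)`. -/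
def MemW1pZero {N : ℕ} (Ω : Set (Rn N)) (p : ℝ) (u : Rn N → ℝ) (g : Rn N → Rn N) : Prop :=
  MemW1p Ω p u g ∧
    ∃ ψ : ℕ → Rn N → ℝ, (∀ n, IsTestFunction Ω (ψ n)) ∧
      Tendsto (fun n => eLpNorm (fun x => ψ n x - u x) (ENNReal.ofReal p) (volume.restrict Ω))
        atTop (𝓝 0) ∧
      Tendsto (fun n => eLpNorm (fun x => gradient (ψ n) x - g x) (ENNReal.ofReal p)
        (volume.restrict Ω)) atTop (𝓝 0)

/-- `f : E × ℝ^{N+1} → ℝ` is a Carathéodory function with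
`C₀ |ξ|^p ≤ f(x, s, ξ) ≤ C₁ |ξ|^p`. Values of `f` for `x ∉ E` play no role. -/
structure IsIntegrand {N : ℕ} (E : Set (Rn N)) (p C₀ C₁ : ℝ)
    (f : Rn N → ℝ → Rn N → ℝ) : Prop where
  measurable : ∀ (s : ℝ) (ξ : Rn N), AEMeasurable (fun x => f x s ξ) (volume.restrict E)
  continuous : ∀ᵐ x ∂(volume.restrict E), Continuous fun z : ℝ × Rn N => f x z.1 z.2
  bounds : ∀ᵐ x ∂(volume.restrict E), ∀ (s : ℝ) (ξ : Rn N),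
    C₀ * ‖ξ‖ ^ p ≤ f x s ξ ∧ f x s ξ ≤ C₁ * ‖ξ‖ ^ p

/-- `J(v; A) = ∫_A f(x, v, Dv) dx`, as an element of `[0, ∞]`; it is used for non-negative
integrands only. -/
noncomputable def energy {N : ℕ} (f : Rn N → ℝ → Rn N → ℝ) (A : Set (Rn N))
    (v : Rn N → ℝ) (Dv : Rn N → Rn N) : ℝ≥0∞ :=
  ∫⁻ x in A, ENNReal.ofReal (f x (v x) (Dv x))

/-- `u`, with weak gradient `Du`, is a `Q`-subminimum in the closed set `F` of the functional
`J(v) = ∫_E f(x, v, Dv) dx`: it belongs to `W^{1,p}_loc(ℝ^N)`, and for every non-negative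
`φ ∈ W^{1,p}_loc(ℝ^N)` with `supp φ ⊆ F` one has `J(u) ≤ Q J(u - φ)`, where, as usual for
quasi-minima, the energies of `u` and of `u - φ` are compared on the support of `φ`. -/
def IsQSubminimum {N : ℕ} (E : Set (Rn N)) (p Q : ℝ) (f : Rn N → ℝ → Rn N → ℝ)
    (F : Set (Rn N)) (u : Rn N → ℝ) (Du : Rn N → Rn N) : Prop :=
  MemW1pLoc p u Du ∧
    ∀ (φ : Rn N → ℝ) (Dφ : Rn N → Rn N), MemW1pLoc p φ Dφ →
      (∀ᵐ x, 0 ≤ φ x) → tsupport φ ⊆ F →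
        energy f (E ∩ tsupport φ) u Du ≤
          ENNReal.ofReal Q *
            energy f (E ∩ tsupport φ) (fun x => u x - φ x) (fun x => Du x - Dφ x)

/-- `u = 0` on `U ∩ ∂E` in the Sobolev sense: `η u ∈ W^{1,p}_0(E)` for every
`η ∈ C_c^∞(U)`. -/
def VanishesOnBoundary {N : ℕ} (E : Set (Rn N)) (p : ℝ) (U : Set (Rn N))
    (u : Rn N → ℝ) : Prop :=
  ∀ η : Rn N → ℝ, IsTestFunction U η →
    ∃ G : Rn N → Rn N, MemW1pZero E p (fun x => η x * u x) G

end QMin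

/-!
The estimate comes from testing the sub-minimality of `u` on the superlevel sets of `φ`, for
`φ ∈ C_c^∞` of the ball first.

For `0 < s < t` let `η` be a smooth function of `φ` that is `0` on `{φ ≤ s}` and `1` on `{φ ≥ t}`,
and let `T` be a bounded smooth truncation (`trunc M`) at height of order `M`. The comparison
function `T(u) η`, extended by zero outside `E`, is a Sobolev function on the whole space: near the
support of `φ` the function `u` is a limit of test functions of `E`, so that integration by parts
produces no boundary term on `∂E` (`memW1pLoc_levelTest`). As `T(u) η` is supported in `{φ ≥ s}`
and `u` vanishes where `T(u) η` does in `{φ > s}`, the sub-minimality and the growth of the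
integrand bound `∫_{φ ≥ t} |Du|^p` by a multiple of
`∫_{s ≤ φ < t} |Du|^p + ∫ ((1 - T'(u)) |Du|)^p + (t - s)^{-p} ∫_{s ≤ φ < t} (T(u) |Dφ|)^p`
(`lintegral_superlevel_le`).

Take the levels `Λ r^k`, multiply by `r^{kp}`, and sum over `k`. The left-hand sides add up to a
quantity comparable with `Λ^{-p} ∫ |Du|^p min(φ⁺, Λ)^p`, which is finite; if `r` is close to `1`,
the first terms on the right are absorbed by hole filling; the last terms live on disjoint strips
and add up to `∫ (T(u) |Dφ|)^p` (`exists_lintegral_test_le`).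

It remains to pass to the limit: `φ` is approximated by test functions, which is harmless for the
right-hand side since `T(u)` is bounded; then `M → ∞`, so that `T'(u) → 1` and the error vanishes
by dominated convergence, and finally `Λ → ∞`. The truncation `T` is what makes unbounded `u`
admissible, without a preliminary local bound for `u`.
-/

namespace QMin

variable {N : ℕ}

/-! ### Gradients and weak gradients -/

theorem gradient_eq_zero_of_notMem_tsupport {a : Rn N → ℝ} {x : Rn N} (hx : x ∉ tsupport a) :
    gradient a x = 0 := by
  have h : a =ᶠ[𝓝 x] fun _ => 0 := notMem_tsupport_iff_eventuallyEq.1 hx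
  rw [h.gradient_eq, gradient_fun_const]

theorem continuous_gradient {a : Rn N → ℝ} (ha : ContDiff ℝ 1 a) : Continuous (gradient a) := by
  unfold gradient
  exact (LinearIsometryEquiv.continuous _).comp (ha.continuous_fderiv one_ne_zero)

theorem hasCompactSupport_gradient {a : Rn N → ℝ} (ha : HasCompactSupport a) :
    HasCompactSupport (gradient a) :=
  HasCompactSupport.intro ha fun _ hx => gradient_eq_zero_of_notMem_tsupport hx

theorem integral_smul_gradient_eq_neg {a θ : Rn N → ℝ} (ha : ContDiff ℝ 1 a)
    (hθ : ContDiff ℝ 1 θ) (hθc : HasCompactSupport θ) :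
    ∫ x, a x • gradient θ x = -∫ x, θ x • gradient a x := by
  have i1 : Integrable fun x => a x • gradient θ x :=
    (ha.continuous.smul (continuous_gradient hθ)).integrable_of_hasCompactSupport
      (hasCompactSupport_gradient hθc).smul_left
  have i2 : Integrable fun x => θ x • gradient a x :=
    (hθ.continuous.smul (continuous_gradient ha)).integrable_of_hasCompactSupport
      hθc.smul_right
  refine ext_inner_right ℝ fun v => ?_
  rw [inner_neg_left, real_inner_comm, real_inner_comm v, ← integral_inner i1, ← integral_inner i2]
  have e1 : ∀ x, inner ℝ v (a x • gradient θ x) = a x * fderiv ℝ θ x v := fun x => by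
    rw [inner_smul_right, real_inner_comm, inner_gradient_left]
  have e2 : ∀ x, inner ℝ v (θ x • gradient a x) = fderiv ℝ a x v * θ x := fun x => by
    rw [inner_smul_right, real_inner_comm, inner_gradient_left, mul_comm]
  simp_rw [e1, e2]
  refine integral_mul_fderiv_eq_neg_fderiv_mul_of_integrable ?_ ?_ ?_
    (fun x _ => (ha.differentiable one_ne_zero) x) (fun x _ => (hθ.differentiable one_ne_zero) x)
  · simpa only [e2] using i2.const_inner (𝕜 := ℝ) v
  · simpa only [e1] using i1.const_inner (𝕜 := ℝ) v
  · exact (ha.continuous.mul hθ.continuous).integrable_of_hasCompactSupport hθc.mul_left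

/-- Weak gradients are local: they agree almost everywhere on an open set on which the functions
agree. -/
theorem HasWeakGradient.ae_eq {Ω₁ Ω₂ O : Set (Rn N)} {u₁ u₂ : Rn N → ℝ} {g₁ g₂ : Rn N → Rn N}
    (h₁ : HasWeakGradient Ω₁ u₁ g₁) (h₂ : HasWeakGradient Ω₂ u₂ g₂) (hO : IsOpen O)
    (hO₁ : O ⊆ Ω₁) (hO₂ : O ⊆ Ω₂) (h : ∀ x ∈ O, u₁ x = u₂ x) :
    ∀ᵐ x, x ∈ O → g₁ x = g₂ x := by
  have key : ∀ᵐ x, x ∈ O → (g₁ - g₂) x = 0 := by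
    refine hO.ae_eq_zero_of_integral_contDiff_smul_eq_zero
      ((h₁.2.1.mono_set hO₁).sub (h₂.2.1.mono_set hO₂)) fun θ hθ hθc hθO => ?_
    have t₁ := h₁.2.2 θ ⟨hθ, hθc, hθO.trans hO₁⟩
    have t₂ := h₂.2.2 θ ⟨hθ, hθc, hθO.trans hO₂⟩
    have e : ∫ x, u₁ x • gradient θ x = ∫ x, u₂ x • gradient θ x := by
      refine integral_congr_ae (Eventually.of_forall fun x => ?_)
      by_cases hx : x ∈ tsupport θ
      · simp only [h x (hθO hx)]
      · simp [gradient_eq_zero_of_notMem_tsupport hx]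
    have int : ∀ g : Rn N → Rn N, LocallyIntegrableOn g O → Integrable fun x => θ x • g x := by
      intro g hg
      have hK : IntegrableOn (fun x => θ x • g x) (tsupport θ) :=
        (hg.integrableOn_compact_subset hθO hθc).continuousOn_smul hθ.continuous.continuousOn hθc
      refine (integrableOn_iff_integrable_of_support_subset ?_).1 hK
      intro x hx
      refine subset_tsupport θ fun h0 => hx ?_
      simp [h0]
    simp only [Pi.sub_apply, smul_sub]
    rw [integral_sub (int _ (h₁.2.1.mono_set hO₁)) (int _ (h₂.2.1.mono_set hO₂))]
    rw [t₁, t₂] at e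
    rw [neg_inj.1 e, sub_self]
  filter_upwards [key] with x hx hxO using sub_eq_zero.1 (hx hxO)

theorem hasWeakGradient_zero (Ω : Set (Rn N)) :
    HasWeakGradient Ω (fun _ => 0) (fun _ => 0) :=
  ⟨(locallyIntegrable_const 0).locallyIntegrableOn Ω,
    (locallyIntegrable_const 0).locallyIntegrableOn Ω, fun η _ => by simp⟩

/-! ### Smooth truncations -/

/-- A smooth bounded truncation at height of order `M`: it is dominated by the identity on
`[0, ∞)`, and tends to the identity as `M → ∞`. -/
noncomputable def trunc (M t : ℝ) : ℝ := M * Real.arctan (t / M)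

/-- The derivative of `trunc M`. -/
noncomputable def truncDeriv (M t : ℝ) : ℝ := 1 / (1 + (t / M) ^ 2)

theorem hasDerivAt_trunc {M : ℝ} (hM : 0 < M) (t : ℝ) :
    HasDerivAt (trunc M) (truncDeriv M t) t := by
  have h := (((hasDerivAt_id t).div_const M).arctan).const_mul M
  unfold trunc truncDeriv
  convert! h using 1
  simp
  field_simp

theorem contDiff_trunc (M : ℝ) : ContDiff ℝ ∞ (trunc M) :=
  contDiff_const.mul (Real.contDiff_arctan.comp (contDiff_id.div_const M))

theorem continuous_truncDeriv (M : ℝ) : Continuous (truncDeriv M) :=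
  continuous_const.div (by fun_prop) fun t => by positivity

theorem trunc_zero (M : ℝ) : trunc M 0 = 0 := by simp [trunc]

theorem truncDeriv_nonneg (M t : ℝ) : 0 ≤ truncDeriv M t := by unfold truncDeriv; positivity

theorem truncDeriv_le_one (M t : ℝ) : truncDeriv M t ≤ 1 := by
  unfold truncDeriv
  rw [div_le_one (by positivity)]
  nlinarith [sq_nonneg (t / M)]

theorem abs_trunc_le {M : ℝ} (hM : 0 < M) (t : ℝ) : |trunc M t| ≤ 2 * M := by
  rw [trunc, abs_mul, abs_of_pos hM, mul_comm 2]
  refine mul_le_mul_of_nonneg_left ?_ hM.le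
  have h1 := Real.arctan_lt_pi_div_two (t / M)
  have h2 := Real.neg_pi_div_two_lt_arctan (t / M)
  rw [abs_le]
  constructor <;> linarith [Real.pi_lt_four]

theorem trunc_nonneg {M t : ℝ} (hM : 0 < M) (ht : 0 ≤ t) : 0 ≤ trunc M t :=
  mul_nonneg hM.le (Real.arctan_nonneg.2 (by positivity))

theorem trunc_le {M t : ℝ} (hM : 0 < M) (ht : 0 ≤ t) : trunc M t ≤ t := by
  have h : Real.arctan (t / M) ≤ t / M := by
    simpa only [Real.tan_arctan] using Real.le_tan (Real.arctan_nonneg.2 (by positivity))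
      (Real.arctan_lt_pi_div_two (t / M))
  calc trunc M t ≤ M * (t / M) := mul_le_mul_of_nonneg_left h hM.le
    _ = t := by field_simp

theorem eq_zero_of_trunc_eq_zero {M t : ℝ} (hM : 0 < M) (h : trunc M t = 0) : t = 0 := by
  simpa [trunc, hM.ne'] using h

theorem tendsto_truncDeriv (t : ℝ) :
    Tendsto (fun n : ℕ => truncDeriv ((n : ℝ) + 1) t) atTop (𝓝 1) := by
  have h : Tendsto (fun n : ℕ => t / ((n : ℝ) + 1)) atTop (𝓝 0) :=
    tendsto_const_nhds.div_atTop (tendsto_atTop_add_const_right _ _ tendsto_natCast_atTop_atTop)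
  have h2 := ((h.pow 2).const_add 1).inv₀ (by norm_num)
  simpa [truncDeriv, one_div] using h2

/-! ### Cutoffs between two levels of a smooth function -/

/-- The smooth cutoff equal to `0` on `{φ ≤ s}` and to `1` on `{φ ≥ t}`. -/
noncomputable def levelCutoff (s t : ℝ) (φ : Rn N → ℝ) (x : Rn N) : ℝ :=
  Real.smoothTransition ((φ x - s) / (t - s))

theorem exists_abs_deriv_smoothTransition_le :
    ∃ L : ℝ, 0 < L ∧ ∀ r, |deriv Real.smoothTransition r| ≤ L := by
  have hc : Continuous (deriv Real.smoothTransition) :=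
    (Real.smoothTransition.contDiff (n := 1)).continuous_deriv le_rfl
  obtain ⟨C, hC⟩ := isCompact_Icc.exists_bound_of_continuousOn (s := Set.Icc (0 : ℝ) 1)
    hc.continuousOn
  refine ⟨max C 1, by positivity, fun r => ?_⟩
  rcases lt_or_ge r 0 with h | h
  · have : Real.smoothTransition =ᶠ[𝓝 r] fun _ => 0 := by
      filter_upwards [gt_mem_nhds h] with z hz using Real.smoothTransition.zero_of_nonpos hz.le
    rw [this.deriv_eq]
    simp
  rcases lt_or_ge 1 r with h' | h'
  · have : Real.smoothTransition =ᶠ[𝓝 r] fun _ => 1 := by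
      filter_upwards [lt_mem_nhds h'] with z hz using Real.smoothTransition.one_of_one_le hz.le
    rw [this.deriv_eq]
    simp
  · exact (hC r ⟨h, h'⟩).trans (le_max_left _ _)

theorem contDiff_levelCutoff {φ : Rn N → ℝ} (hφ : ContDiff ℝ ∞ φ) (s t : ℝ) :
    ContDiff ℝ ∞ (levelCutoff s t φ) :=
  Real.smoothTransition.contDiff.comp ((hφ.sub contDiff_const).div_const _)

theorem levelCutoff_nonneg (s t : ℝ) (φ : Rn N → ℝ) (x : Rn N) : 0 ≤ levelCutoff s t φ x :=
  Real.smoothTransition.nonneg _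

theorem levelCutoff_le_one (s t : ℝ) (φ : Rn N → ℝ) (x : Rn N) : levelCutoff s t φ x ≤ 1 :=
  Real.smoothTransition.le_one _

theorem levelCutoff_eq_zero {s t : ℝ} (hst : s < t) {φ : Rn N → ℝ} {x : Rn N} (h : φ x ≤ s) :
    levelCutoff s t φ x = 0 :=
  Real.smoothTransition.zero_of_nonpos (div_nonpos_of_nonpos_of_nonneg (by linarith) (by linarith))

theorem levelCutoff_pos {s t : ℝ} (hst : s < t) {φ : Rn N → ℝ} {x : Rn N} (h : s < φ x) :
    0 < levelCutoff s t φ x :=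
  Real.smoothTransition.pos_of_pos (div_pos (by linarith) (by linarith))

theorem levelCutoff_eq_one {s t : ℝ} (hst : s < t) {φ : Rn N → ℝ} {x : Rn N} (h : t ≤ φ x) :
    levelCutoff s t φ x = 1 :=
  Real.smoothTransition.one_of_one_le ((one_le_div (by linarith)).2 (by linarith))

theorem hasGradientAt_comp {h : ℝ → ℝ} {h' : ℝ} {a : Rn N → ℝ} {g x : Rn N}
    (hh : HasDerivAt h h' (a x)) (ha : HasGradientAt a g x) :
    HasGradientAt (fun z => h (a z)) (h' • g) x := by
  rw [hasGradientAt_iff_hasFDerivAt] at ha ⊢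
  rw [map_smul]
  exact hh.comp_hasFDerivAt x ha

theorem hasGradientAt_mul {a b : Rn N → ℝ} {g h x : Rn N}
    (ha : HasGradientAt a g x) (hb : HasGradientAt b h x) :
    HasGradientAt (fun z => a z * b z) (a x • h + b x • g) x := by
  rw [hasGradientAt_iff_hasFDerivAt] at ha hb ⊢
  rw [map_add, map_smul, map_smul]
  exact ha.mul hb

theorem gradient_levelCutoff {φ : Rn N → ℝ} (hφ : ContDiff ℝ ∞ φ) (s t : ℝ) (x : Rn N) :
    gradient (levelCutoff s t φ) x =
      (deriv Real.smoothTransition ((φ x - s) / (t - s)) * (1 / (t - s))) • gradient φ x := by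
  have h1 : HasGradientAt φ (gradient φ x) x :=
    ((hφ.differentiable (by simp)) x).hasGradientAt
  have h2 : HasDerivAt (fun r : ℝ => Real.smoothTransition ((r - s) / (t - s)))
      (deriv Real.smoothTransition ((φ x - s) / (t - s)) * (1 / (t - s))) (φ x) := by
    have hd : HasDerivAt Real.smoothTransition
        (deriv Real.smoothTransition ((φ x - s) / (t - s))) ((φ x - s) / (t - s)) :=
      ((Real.smoothTransition.contDiff (n := 1)).differentiable one_ne_zero _).hasDerivAt
    exact HasDerivAt.comp (h := fun r : ℝ => (r - s) / (t - s)) (φ x) hd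
      (((hasDerivAt_id (φ x)).sub_const s).div_const (t - s))
  exact (hasGradientAt_comp h2 h1).gradient

theorem norm_gradient_levelCutoff_le {L : ℝ} (hL : ∀ r, |deriv Real.smoothTransition r| ≤ L)
    {φ : Rn N → ℝ} (hφ : ContDiff ℝ ∞ φ) {s t : ℝ} (hst : s < t) (x : Rn N) :
    ‖gradient (levelCutoff s t φ) x‖ ≤ L / (t - s) * ‖gradient φ x‖ := by
  have h0 : 0 < t - s := by linarith
  rw [gradient_levelCutoff hφ, norm_smul, Real.norm_eq_abs, abs_mul, abs_of_pos (one_div_pos.2 h0),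
    mul_one_div]
  gcongr
  exact hL _

theorem gradient_levelCutoff_eq_zero_of_le {φ : Rn N → ℝ} {s t : ℝ} (hst : s < t) {x : Rn N}
    (h : t ≤ φ x) : gradient (levelCutoff s t φ) x = 0 := by
  have : IsLocalMax (levelCutoff s t φ) x := Eventually.of_forall fun z => by
    rw [levelCutoff_eq_one hst h]
    exact levelCutoff_le_one _ _ _ _
  simp [gradient, this.fderiv_eq_zero]

theorem gradient_levelCutoff_eq_zero_of_ge {φ : Rn N → ℝ} {s t : ℝ} (hst : s < t) {x : Rn N}
    (h : φ x ≤ s) : gradient (levelCutoff s t φ) x = 0 := by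
  have : IsLocalMin (levelCutoff s t φ) x := Eventually.of_forall fun z => by
    rw [levelCutoff_eq_zero hst h]
    exact levelCutoff_nonneg _ _ _ _
  simp [gradient, this.fderiv_eq_zero]

/-! ### The truncated test functions belong to the Sobolev space -/

/-- Bounded coefficients that converge almost everywhere, times vector fields that converge in
`L^q`, converge in the mean. -/
theorem tendsto_integral_smul_of_bounded {μ : Measure (Rn N)} [IsFiniteMeasure μ] {q : ℝ≥0∞}
    (hq : 1 ≤ q) {c : ℕ → Rn N → ℝ} {c' : Rn N → ℝ} {h : ℕ → Rn N → Rn N} {h' : Rn N → Rn N}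
    {C : ℝ} (hc : ∀ n, AEStronglyMeasurable (c n) μ) (hb : ∀ n x, |c n x| ≤ C)
    (hlim : ∀ᵐ x ∂μ, Tendsto (fun n => c n x) atTop (𝓝 (c' x)))
    (hh : ∀ n, MemLp (h n) q μ) (hh' : MemLp h' q μ)
    (hhlim : Tendsto (fun n => eLpNorm (fun x => h n x - h' x) q μ) atTop (𝓝 0)) :
    Tendsto (fun n => ∫ x, c n x • h n x ∂μ) atTop (𝓝 (∫ x, c' x • h' x ∂μ)) := by
  have bd : ∀ (n : ℕ) (g : Rn N → Rn N), MemLp g q μ → Integrable (fun x => c n x • g x) μ :=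
    fun n g hg => (hg.integrable hq).bdd_smul C (hc n) (Eventually.of_forall fun x => hb n x)
  have t1 : Tendsto (fun n => ∫ x, c n x • (h n x - h' x) ∂μ) atTop (𝓝 0) := by
    have t : Tendsto (fun n => eLpNorm (fun x => h n x - h' x) 1 μ) atTop (𝓝 0) := by
      have hfin : μ Set.univ ^ (1 / (1 : ℝ≥0∞).toReal - 1 / q.toReal) ≠ ⊤ := by
        refine ENNReal.rpow_ne_top_of_nonneg ?_ (measure_ne_top _ _)
        rcases eq_or_ne q ⊤ with rfl | hqt
        · simp
        · have : 1 ≤ q.toReal := by simpa using ENNReal.toReal_mono hqt hq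
          simpa using inv_le_one_of_one_le₀ this
      have t' := ENNReal.Tendsto.mul_const hhlim (Or.inr hfin)
      rw [zero_mul] at t'
      exact tendsto_of_tendsto_of_tendsto_of_le_of_le tendsto_const_nhds t' (fun _ => zero_le)
        fun n => eLpNorm_le_eLpNorm_mul_rpow_measure_univ hq ((hh n).sub hh').1
    have t2 : Tendsto (fun n => eLpNorm (fun x => c n x • (h n x - h' x)) 1 μ) atTop (𝓝 0) := by
      have t' := ENNReal.Tendsto.const_mul (a := ENNReal.ofReal C) t (Or.inr ENNReal.ofReal_ne_top)
      rw [mul_zero] at t'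
      refine tendsto_of_tendsto_of_tendsto_of_le_of_le tendsto_const_nhds t' (fun _ => zero_le)
        fun n => eLpNorm_le_mul_eLpNorm_of_ae_le_mul (Eventually.of_forall fun x => ?_) 1
      rw [norm_smul]
      exact mul_le_mul_of_nonneg_right (hb n x) (norm_nonneg _)
    have := tendsto_integral_of_L1' (μ := μ) (fun _ : Rn N => (0 : Rn N)) (by fun_prop)
      (F := fun n x => c n x • (h n x - h' x))
      (Eventually.of_forall fun n => bd n _ ((hh n).sub hh')) (l := atTop)
      (by simpa [Pi.sub_def] using t2)
    simpa using this
  have t2 : Tendsto (fun n => ∫ x, c n x • h' x ∂μ) atTop (𝓝 (∫ x, c' x • h' x ∂μ)) := by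
    refine tendsto_integral_of_dominated_convergence (fun x => C * ‖h' x‖)
      (fun n => (bd n _ hh').1) ((hh'.integrable hq).norm.const_mul C)
      (fun n => Eventually.of_forall fun x => ?_) ?_
    · rw [norm_smul]
      exact mul_le_mul_of_nonneg_right (hb n x) (norm_nonneg _)
    · filter_upwards [hlim] with x hx using hx.smul_const _
  have := t1.add t2
  rw [zero_add] at this
  refine this.congr fun n => ?_
  have := integral_sub (bd n _ (hh n)) (bd n _ hh')
  simp only [smul_sub, this, sub_add_cancel]

/-- Chain and product rule for the extension by zero of `trunc M w * η`, where `w` is a limit of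
test functions of `E` in the Sobolev norm: there is no boundary term on `∂E`, although `η` need not
vanish there. -/
theorem integral_indicator_trunc_mul_smul_gradient {E : Set (Rn N)} (hE : MeasurableSet E)
    (hEfin : volume E ≠ ⊤) {p : ℝ} (hp : 1 < p) {w : Rn N → ℝ} {G : Rn N → Rn N}
    (hw : MemW1pZero E p w G) {M : ℝ} (hM : 0 < M) {η : Rn N → ℝ} (hη : ContDiff ℝ ∞ η)
    (hηc : HasCompactSupport η) {θ : Rn N → ℝ} (hθ : ContDiff ℝ ∞ θ) (hθc : HasCompactSupport θ) :
    ∫ x, E.indicator (fun x => trunc M (w x) * η x) x • gradient θ x =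
      -∫ x, θ x • E.indicator
        (fun x => (truncDeriv M (w x) * η x) • G x + trunc M (w x) • gradient η x) x := by
  obtain ⟨⟨-, hwp, hGp⟩, ζ, hζ, hζw, hζG⟩ := hw
  have hq : (1 : ℝ≥0∞) ≤ ENNReal.ofReal p := by simpa using ENNReal.ofReal_le_ofReal hp.le
  have hq0 : ENNReal.ofReal p ≠ 0 := (zero_lt_one.trans_le hq).ne'
  have : IsFiniteMeasure (volume.restrict E) := ⟨by simpa using hEfin.lt_top⟩
  have hζ1 : ∀ n, ContDiff ℝ 1 (ζ n) := fun n => (hζ n).1.of_le (by simp)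
  have hη1 : ContDiff ℝ 1 η := hη.of_le (by simp)
  have hθ1 : ContDiff ℝ 1 θ := hθ.of_le (by simp)
  obtain ⟨ns, hns, hae⟩ := (tendstoInMeasure_of_tendsto_eLpNorm hq0
    (fun n => ((hζ n).1.continuous.aestronglyMeasurable)) hwp.1 hζw).exists_seq_tendsto_ae
  have hcT : Continuous (trunc M) := (contDiff_trunc M).continuous
  have hcT' : Continuous (truncDeriv M) := continuous_truncDeriv M
  obtain ⟨Cη, hCη⟩ := hηc.exists_bound_of_continuous hη.continuous
  obtain ⟨Cθ, hCθ⟩ := hθc.exists_bound_of_continuous hθ.continuous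
  have bdp : ∀ a : Rn N → ℝ, ContDiff ℝ 1 a → HasCompactSupport a →
      MemLp (gradient a) (ENNReal.ofReal p) (volume.restrict E) := fun a ha hac =>
    ((continuous_gradient ha).memLp_of_hasCompactSupport
      (hasCompactSupport_gradient hac)).restrict E
  have cst : ∀ h : Rn N → Rn N, Tendsto (fun n : ℕ => eLpNorm (fun x => h x - h x)
      (ENNReal.ofReal p) (volume.restrict E)) atTop (𝓝 0) := fun h => by simp
  have hCη0 : 0 ≤ Cη := (norm_nonneg _).trans (hCη 0)
  have hCθ0 : 0 ≤ Cθ := (norm_nonneg _).trans (hCθ 0)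
  -- the three limits
  have tA := tendsto_integral_smul_of_bounded (μ := volume.restrict E) hq
    (c := fun n x => trunc M (ζ (ns n) x) * η x) (c' := fun x => trunc M (w x) * η x)
    (h := fun _ => gradient θ) (C := 2 * M * Cη)
    (fun n => ((hcT.comp (hζ (ns n)).1.continuous).mul hη.continuous).aestronglyMeasurable)
    (fun n x => by
      rw [abs_mul]
      exact mul_le_mul (abs_trunc_le hM _) (hCη x) (abs_nonneg _) (by positivity))
    (by
      filter_upwards [hae] with x hx
      exact ((hcT.tendsto _).comp hx).mul_const _)
    (fun _ => bdp θ hθ1 hθc) (bdp θ hθ1 hθc) (cst _)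
  have tB := tendsto_integral_smul_of_bounded (μ := volume.restrict E) hq
    (c := fun n x => θ x * trunc M (ζ (ns n) x)) (c' := fun x => θ x * trunc M (w x))
    (h := fun _ => gradient η) (C := Cθ * (2 * M))
    (fun n => (hθ.continuous.mul (hcT.comp (hζ (ns n)).1.continuous)).aestronglyMeasurable)
    (fun n x => by
      rw [abs_mul]
      exact mul_le_mul (hCθ x) (abs_trunc_le hM _) (abs_nonneg _) hCθ0)
    (by
      filter_upwards [hae] with x hx
      exact ((hcT.tendsto _).comp hx).const_mul _)
    (fun _ => bdp η hη1 hηc) (bdp η hη1 hηc) (cst _)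
  have tC := tendsto_integral_smul_of_bounded (μ := volume.restrict E) hq
    (c := fun n x => θ x * (truncDeriv M (ζ (ns n) x) * η x))
    (c' := fun x => θ x * (truncDeriv M (w x) * η x))
    (h := fun n => gradient (ζ (ns n))) (C := Cθ * (1 * Cη))
    (fun n => (hθ.continuous.mul
      ((hcT'.comp (hζ (ns n)).1.continuous).mul hη.continuous)).aestronglyMeasurable)
    (fun n x => by
      rw [abs_mul, abs_mul, abs_of_nonneg (truncDeriv_nonneg _ _)]
      exact mul_le_mul (hCθ x) (mul_le_mul (truncDeriv_le_one _ _) (hCη x) (abs_nonneg _)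
        zero_le_one) (mul_nonneg (truncDeriv_nonneg _ _) (abs_nonneg _)) hCθ0)
    (by
      filter_upwards [hae] with x hx
      exact (((hcT'.tendsto _).comp hx).mul_const _).const_mul _)
    (fun n => bdp _ (hζ1 _) (hζ (ns n)).2.1) hGp (hζG.comp hns.tendsto_atTop)
  have bdi : ∀ (c : Rn N → ℝ) (g : Rn N → Rn N) (C : ℝ),
      AEStronglyMeasurable c (volume.restrict E) → (∀ x, |c x| ≤ C) →
      MemLp g (ENNReal.ofReal p) (volume.restrict E) →
      Integrable (fun x => c x • g x) (volume.restrict E) := fun c g C hc hb hg =>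
    (hg.integrable hq).bdd_smul C hc (Eventually.of_forall hb)
  have split : ∀ (v : Rn N → ℝ) (g : Rn N → Rn N), AEStronglyMeasurable v (volume.restrict E) →
      MemLp g (ENNReal.ofReal p) (volume.restrict E) →
      ∫ x in E, θ x • ((truncDeriv M (v x) * η x) • g x + trunc M (v x) • gradient η x) =
      (∫ x in E, (θ x * (truncDeriv M (v x) * η x)) • g x) +
        ∫ x in E, (θ x * trunc M (v x)) • gradient η x := by
    intro v g hv hg
    rw [← integral_add]
    · simp only [smul_add, smul_smul]
    · refine bdi _ _ (Cθ * (1 * Cη)) (hθ.continuous.aestronglyMeasurable.mul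
        ((hcT'.comp_aestronglyMeasurable hv).mul hη.continuous.aestronglyMeasurable))
        (fun x => ?_) hg
      rw [abs_mul, abs_mul, abs_of_nonneg (truncDeriv_nonneg _ _)]
      exact mul_le_mul (hCθ x) (mul_le_mul (truncDeriv_le_one _ _) (hCη x) (abs_nonneg _)
        zero_le_one) (mul_nonneg (truncDeriv_nonneg _ _) (abs_nonneg _)) hCθ0
    · refine bdi _ _ (Cθ * (2 * M)) (hθ.continuous.aestronglyMeasurable.mul
        (hcT.comp_aestronglyMeasurable hv)) (fun x => ?_) (bdp η hη1 hηc)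
      rw [abs_mul]
      exact mul_le_mul (hCθ x) (abs_trunc_le hM _) (abs_nonneg _) hCθ0
  have e : ∀ n, ∫ x in E, (trunc M (ζ (ns n) x) * η x) • gradient θ x =
      -((∫ x in E, (θ x * (truncDeriv M (ζ (ns n) x) * η x)) • gradient (ζ (ns n)) x) +
        ∫ x in E, (θ x * trunc M (ζ (ns n) x)) • gradient η x) := by
    intro n
    have hz : ∀ x ∉ E, ζ (ns n) x = 0 := fun x hx =>
      image_eq_zero_of_notMem_tsupport fun h => hx ((hζ (ns n)).2.2 h)
    have hgz : ∀ x ∉ E, gradient (ζ (ns n)) x = 0 := fun x hx =>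
      gradient_eq_zero_of_notMem_tsupport fun h => hx ((hζ (ns n)).2.2 h)
    rw [← split _ _ (hζ (ns n)).1.continuous.aestronglyMeasurable (bdp _ (hζ1 _) (hζ (ns n)).2.1)]
    rw [setIntegral_eq_integral_of_forall_compl_eq_zero (fun x hx => by simp [hz x hx, trunc_zero]),
      setIntegral_eq_integral_of_forall_compl_eq_zero
        (fun x hx => by simp [hz x hx, hgz x hx, trunc_zero])]
    have ha : ContDiff ℝ 1 fun x => trunc M (ζ (ns n) x) * η x :=
      ((((contDiff_trunc M).of_le (by simp)).comp (hζ1 (ns n))).mul hη1)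
    rw [integral_smul_gradient_eq_neg ha hθ1 hθc]
    congr 1
    refine integral_congr_ae (Eventually.of_forall fun x => ?_)
    have hg := hasGradientAt_mul (hasGradientAt_comp (hasDerivAt_trunc hM (ζ (ns n) x))
      ((hζ1 (ns n)).differentiable one_ne_zero x).hasGradientAt)
      (hη1.differentiable one_ne_zero x).hasGradientAt
    simp only [hg.gradient, smul_smul]
    rw [add_comm, mul_comm (η x)]
  have lim := tendsto_nhds_unique tA ((tC.add tB).neg.congr fun n => (e n).symm)
  rw [← split w G hwp.1 hGp] at lim
  rw [← integral_indicator hE, ← integral_indicator hE] at lim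
  convert! lim using 2
  · ext1 x
    by_cases hx : x ∈ E <;> simp [hx]
  · congr 1
    ext1 x
    by_cases hx : x ∈ E <;> simp [hx]

theorem exists_isTestFunction_eq_one {U K : Set (Rn N)} (hU : IsOpen U) (hK : IsCompact K)
    (hKU : K ⊆ U) : ∃ χ : Rn N → ℝ, IsTestFunction U χ ∧ ∀ x ∈ K, χ x = 1 := by
  obtain ⟨L, hL, hKL, hLU⟩ := exists_compact_between hK hU hKU
  obtain ⟨χ, hχ, -, hs, h1⟩ := exists_contMDiff_support_eq_eq_one_iff (n := (⊤ : ℕ∞))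
    (modelWithCornersSelf ℝ (Rn N)) isOpen_interior hK.isClosed hKL
  have hsub : tsupport χ ⊆ L := by
    rw [tsupport, hs]
    exact closure_minimal interior_subset hL.isClosed
  exact ⟨χ, ⟨hχ.contDiff, hL.of_isClosed_subset (isClosed_tsupport χ) hsub, hsub.trans hLU⟩,
    fun x hx => (h1 x).1 hx⟩

theorem locallyIntegrableOn_univ_of_memLp {F : Type*} [NormedAddCommGroup F] {q : ℝ≥0∞}
    (hq : 1 ≤ q) {g : Rn N → F}
    (h : ∀ K : Set (Rn N), IsCompact K → MemLp g q (volume.restrict K)) :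
    LocallyIntegrableOn g Set.univ := by
  rw [locallyIntegrableOn_univ, locallyIntegrable_iff]
  intro K hK
  have : IsFiniteMeasure (volume.restrict K) := ⟨by simpa using hK.measure_lt_top⟩
  exact (h K hK).integrable hq

/-- The comparison function `T(u) η` on `E`, extended by zero, where `T` is the truncation at
height `M` and `η` is the cutoff between the levels `s` and `t` of `φ`. -/
noncomputable def levelTest (E : Set (Rn N)) (M s t : ℝ) (u φ : Rn N → ℝ) : Rn N → ℝ :=
  E.indicator fun x => trunc M (u x) * levelCutoff s t φ x

/-- The weak gradient of `levelTest`. -/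
noncomputable def levelTestGrad (E : Set (Rn N)) (M s t : ℝ) (u : Rn N → ℝ) (Du : Rn N → Rn N)
    (φ : Rn N → ℝ) : Rn N → Rn N :=
  E.indicator fun x => (truncDeriv M (u x) * levelCutoff s t φ x) • Du x +
    trunc M (u x) • gradient (levelCutoff s t φ) x

theorem hasCompactSupport_levelCutoff {s t : ℝ} (hs : 0 < s) (hst : s < t) {φ : Rn N → ℝ}
    (hφ : HasCompactSupport φ) : HasCompactSupport (levelCutoff s t φ) :=
  HasCompactSupport.intro hφ fun x hx => levelCutoff_eq_zero hst <| by
    rw [image_eq_zero_of_notMem_tsupport hx]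
    exact hs.le

/-- The comparison function is a Sobolev function on the whole space: `u` is replaced by `χ u`
with a test function `χ` of `U` equal to `1` on the support of `φ`, and `χ u` is a limit of test
functions of `E`. -/
theorem memW1pLoc_levelTest {E U : Set (Rn N)} (hE : IsOpen E) (hEb : Bornology.IsBounded E)
    (hU : IsOpen U) {p : ℝ} (hp : 1 < p) {u : Rn N → ℝ} {Du : Rn N → Rn N}
    (hu : MemW1pLoc p u Du) (hu0 : VanishesOnBoundary E p U u) {M s t : ℝ} (hM : 0 < M)
    (hs : 0 < s) (hst : s < t) {φ : Rn N → ℝ} (hφ : IsTestFunction U φ) :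
    MemW1pLoc p (levelTest E M s t u φ) (levelTestGrad E M s t u Du φ) := by
  obtain ⟨χ, hχ, hχ1⟩ := exists_isTestFunction_eq_one hU hφ.2.1 hφ.2.2
  obtain ⟨G, hG⟩ := hu0 χ hχ
  have hη := contDiff_levelCutoff hφ.1 s t
  have hηc := hasCompactSupport_levelCutoff hs hst hφ.2.1
  have hq : (1 : ℝ≥0∞) ≤ ENNReal.ofReal p := by simpa using ENNReal.ofReal_le_ofReal hp.le
  have hEm := hE.measurableSet
  have hum : AEStronglyMeasurable u volume := by
    have := hu.1.1.aestronglyMeasurable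
    rwa [Measure.restrict_univ] at this
  have hDum : AEStronglyMeasurable Du volume := by
    have := hu.1.2.1.aestronglyMeasurable
    rwa [Measure.restrict_univ] at this
  have hcT : Continuous (trunc M) := (contDiff_trunc M).continuous
  have hcT' : Continuous (truncDeriv M) := continuous_truncDeriv M
  have hgη : Continuous (gradient (levelCutoff s t φ)) :=
    continuous_gradient (hη.of_le (by simp))
  have hψm : AEStronglyMeasurable (levelTest E M s t u φ) volume :=
    ((hcT.comp_aestronglyMeasurable hum).mul hη.continuous.aestronglyMeasurable).indicator hEm
  have hgm : AEStronglyMeasurable (levelTestGrad E M s t u Du φ) volume :=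
    ((((hcT'.comp_aestronglyMeasurable hum).mul hη.continuous.aestronglyMeasurable).smul hDum).add
      ((hcT.comp_aestronglyMeasurable hum).smul hgη.aestronglyMeasurable)).indicator hEm
  have hLp : ∀ K : Set (Rn N), IsCompact K →
      MemLp (levelTest E M s t u φ) (ENNReal.ofReal p) (volume.restrict K) ∧
      MemLp (levelTestGrad E M s t u Du φ) (ENNReal.ofReal p) (volume.restrict K) := by
    intro K hK
    have : IsFiniteMeasure (volume.restrict K) := ⟨by simpa using hK.measure_lt_top⟩
    constructor
    · refine MemLp.of_bound hψm.restrict (2 * M) (Eventually.of_forall fun x => ?_)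
      by_cases hx : x ∈ E
      · rw [levelTest, Set.indicator_of_mem hx, Real.norm_eq_abs, abs_mul,
          abs_of_nonneg (levelCutoff_nonneg _ _ _ _)]
        exact (mul_le_of_le_one_right (abs_nonneg _) (levelCutoff_le_one _ _ _ _)).trans
          (abs_trunc_le hM _)
      · rw [levelTest, Set.indicator_of_notMem hx]
        simpa using hM.le
    · have h1 : MemLp (fun x => ‖Du x‖ + 2 * M * ‖gradient (levelCutoff s t φ) x‖)
          (ENNReal.ofReal p) (volume.restrict K) := by
        refine (hu.2 K hK).2.norm.add ?_
        exact (((hgη.memLp_of_hasCompactSupport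
          (hasCompactSupport_gradient hηc)).restrict K).norm.const_mul (2 * M))
      refine h1.mono hgm.restrict (Eventually.of_forall fun x => ?_)
      have h0 : 0 ≤ ‖Du x‖ + 2 * M * ‖gradient (levelCutoff s t φ) x‖ := by positivity
      rw [Real.norm_of_nonneg h0]
      by_cases hx : x ∈ E
      · rw [levelTestGrad, Set.indicator_of_mem hx]
        refine (norm_add_le _ _).trans (add_le_add ?_ ?_)
        · rw [norm_smul]
          refine mul_le_of_le_one_left (norm_nonneg _) ?_
          rw [Real.norm_eq_abs, abs_mul, abs_of_nonneg (levelCutoff_nonneg _ _ _ _),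
            abs_of_nonneg (truncDeriv_nonneg _ _)]
          exact mul_le_one₀ (truncDeriv_le_one _ _) (levelCutoff_nonneg _ _ _ _)
            (levelCutoff_le_one _ _ _ _)
        · rw [norm_smul]
          exact mul_le_mul_of_nonneg_right (abs_trunc_le hM _) (norm_nonneg _)
      · rw [levelTestGrad, Set.indicator_of_notMem hx, norm_zero]
        exact h0
  refine ⟨⟨locallyIntegrableOn_univ_of_memLp hq fun K hK => (hLp K hK).1,
    locallyIntegrableOn_univ_of_memLp hq fun K hK => (hLp K hK).2, fun θ hθ => ?_⟩, hLp⟩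
  have key := integral_indicator_trunc_mul_smul_gradient hEm hEb.measure_lt_top.ne hp hG hM hη hηc
    hθ.1 hθ.2.1
  have hone : ∀ x, 0 < φ x → χ x = 1 := fun x hx => hχ1 x (subset_tsupport φ hx.ne')
  -- the weak gradient of `χ u` is that of `u` wherever the cutoff is positive
  have hloc : ∀ᵐ x, x ∈ E ∩ {x | 0 < φ x} → G x = Du x :=
    hG.1.1.ae_eq hu.1 (hE.inter (isOpen_lt continuous_const hφ.1.continuous))
      Set.inter_subset_left (Set.subset_univ _) fun x hx => by simp [hone x hx.2]
  convert! key using 1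
  · congr 1
    ext1 x
    rw [levelTest]
    by_cases hx : x ∈ E
    · rw [Set.indicator_of_mem hx, Set.indicator_of_mem hx]
      rcases le_or_gt (φ x) s with h | h
      · rw [levelCutoff_eq_zero hst h]
        simp
      · rw [hone x (hs.trans h), one_mul]
    · rw [Set.indicator_of_notMem hx, Set.indicator_of_notMem hx]
  · congr 1
    refine integral_congr_ae ?_
    filter_upwards [hloc] with x hx'
    rw [levelTestGrad]
    by_cases hx : x ∈ E
    · rw [Set.indicator_of_mem hx, Set.indicator_of_mem hx]
      rcases le_or_gt (φ x) s with h | h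
      · rw [levelCutoff_eq_zero hst h, gradient_levelCutoff_eq_zero_of_ge hst h]
        simp
      · rw [hone x (hs.trans h), one_mul, hx' ⟨hx, hs.trans h⟩]
    · rw [Set.indicator_of_notMem hx, Set.indicator_of_notMem hx]

theorem tsupport_levelTest_subset {E : Set (Rn N)} {M s t : ℝ} (hst : s < t) {u φ : Rn N → ℝ}
    (hφ : Continuous φ) : tsupport (levelTest E M s t u φ) ⊆ closure E ∩ {x | s ≤ φ x} := by
  refine closure_minimal ?_ (isClosed_closure.inter (isClosed_le continuous_const hφ))
  intro x hx
  have hxE : x ∈ E := by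
    by_contra h
    exact hx (Set.indicator_of_notMem h _)
  refine ⟨subset_closure hxE, ?_⟩
  by_contra h
  refine hx ?_
  rw [levelTest, Set.indicator_of_mem hxE, levelCutoff_eq_zero hst (not_le.1 h).le, mul_zero]

/-! ### The energy estimate between two levels -/

theorem add_add_rpow_le {a b c p : ℝ} (ha : 0 ≤ a) (hb : 0 ≤ b) (hc : 0 ≤ c) (hp : 0 ≤ p) :
    (a + b + c) ^ p ≤ 3 ^ p * (a ^ p + b ^ p + c ^ p) := by
  have a0 := Real.rpow_nonneg ha p
  have b0 := Real.rpow_nonneg hb p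
  have c0 := Real.rpow_nonneg hc p
  have main : ∀ d, 0 ≤ d → a + b + c ≤ 3 * d → d ^ p ≤ a ^ p + b ^ p + c ^ p →
      (a + b + c) ^ p ≤ 3 ^ p * (a ^ p + b ^ p + c ^ p) := by
    intro d hd h h'
    calc (a + b + c) ^ p ≤ (3 * d) ^ p := Real.rpow_le_rpow (by positivity) h hp
      _ = 3 ^ p * d ^ p := Real.mul_rpow (by norm_num) hd
      _ ≤ _ := mul_le_mul_of_nonneg_left h' (by positivity)
  rcases le_total a b with h1 | h1 <;> rcases le_total b c with h2 | h2 <;>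
    rcases le_total a c with h3 | h3
  · exact main c hc (by linarith) (by linarith)
  · exact main c hc (by linarith) (by linarith)
  · exact main b hb (by linarith) (by linarith)
  · exact main b hb (by linarith) (by linarith)
  · exact main c hc (by linarith) (by linarith)
  · exact main a ha (by linarith) (by linarith)
  · exact main a ha (by linarith) (by linarith)
  · exact main a ha (by linarith) (by linarith)

/-- The energy of `Du` on `{φ ≥ t}` is controlled by the energy on the strip `{s ≤ φ < t}`, by an
error due to the truncation of `u`, and by the energy of the cutoff. -/
theorem lintegral_superlevel_le {E U : Set (Rn N)} (hE : IsOpen E) (hEb : Bornology.IsBounded E)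
    (hU : IsOpen U) {p Q C₀ C₁ L : ℝ} (hp : 1 < p) (hQ : 0 ≤ Q) (hC₀ : 0 < C₀) (hC₁ : 0 ≤ C₁)
    (hL0 : 0 ≤ L) (hL : ∀ r, |deriv Real.smoothTransition r| ≤ L)
    {f : Rn N → ℝ → Rn N → ℝ} (hf : IsIntegrand E p C₀ C₁ f)
    {u : Rn N → ℝ} {Du : Rn N → Rn N} (hu : IsQSubminimum E p Q f (closure U ∩ closure E) u Du)
    (hupos : ∀ᵐ x ∂(volume.restrict (U ∩ E)), 0 ≤ u x)
    (hu0 : VanishesOnBoundary E p U u) {M s t : ℝ} (hM : 0 < M)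
    (hs : 0 < s) (hst : s < t) {φ : Rn N → ℝ} (hφ : IsTestFunction U φ) :
    ∫⁻ x in E ∩ {x | t ≤ φ x}, ENNReal.ofReal (‖Du x‖ ^ p) ≤
      ENNReal.ofReal (Q * (C₁ / C₀) * 3 ^ p) *
        ((∫⁻ x in E ∩ {x | s ≤ φ x ∧ φ x < t}, ENNReal.ofReal (‖Du x‖ ^ p)) +
          (∫⁻ x in U ∩ E, ENNReal.ofReal (((1 - truncDeriv M (u x)) * ‖Du x‖) ^ p)) +
          ENNReal.ofReal ((L / (t - s)) ^ p) *
            ∫⁻ x in E ∩ {x | s ≤ φ x ∧ φ x < t},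
              ENNReal.ofReal ((|trunc M (u x)| * ‖gradient φ x‖) ^ p)) := by
  have hp0 : 0 ≤ p := by linarith
  have hEm := hE.measurableSet
  have hUm := hU.measurableSet
  have hφc := hφ.1.continuous
  have hDum : AEStronglyMeasurable Du volume := by
    have := hu.1.1.2.1.aestronglyMeasurable
    rwa [Measure.restrict_univ] at this
  have hum : AEStronglyMeasurable u volume := by
    have := hu.1.1.1.aestronglyMeasurable
    rwa [Measure.restrict_univ] at this
  have hφU : ∀ x, 0 < φ x → x ∈ U := fun x hx => hφ.2.2 (subset_tsupport φ hx.ne')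
  set ψ := levelTest E M s t u φ with hψ
  set Dψ := levelTestGrad E M s t u Du φ with hDψ
  have hψW : MemW1pLoc p ψ Dψ := memW1pLoc_levelTest hE hEb hU hp hu.1 hu0 hM hs hst hφ
  have hsup := tsupport_levelTest_subset (E := E) (M := M) (u := u) hst hφc
  have hψ0 : ∀ᵐ x, 0 ≤ ψ x := by
    filter_upwards [(ae_restrict_iff' (hUm.inter hEm)).1 hupos] with x hx
    by_cases hxE : x ∈ E
    swap
    · rw [hψ, levelTest, Set.indicator_of_notMem hxE]
    rw [hψ, levelTest, Set.indicator_of_mem hxE]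
    rcases le_or_gt (φ x) s with h | h
    · rw [levelCutoff_eq_zero hst h, mul_zero]
    · exact mul_nonneg (trunc_nonneg hM (hx ⟨hφU x (hs.trans h), hxE⟩)) (levelCutoff_nonneg _ _ _ _)
  have hmin := hu.2 ψ Dψ hψW hψ0 fun x hx =>
    ⟨subset_closure (hφU x (hs.trans_le (hsup hx).2)), (hsup hx).1⟩
  have hbE : ∀ᵐ x, x ∈ E → ∀ (r : ℝ) (ξ : Rn N),
      C₀ * ‖ξ‖ ^ p ≤ f x r ξ ∧ f x r ξ ≤ C₁ * ‖ξ‖ ^ p := (ae_restrict_iff' hEm).1 hf.bounds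
  have hts : MeasurableSet (E ∩ tsupport ψ) := hEm.inter (isClosed_tsupport ψ).measurableSet
  have hlt : MeasurableSet {x | φ x < t} := (isOpen_lt hφc continuous_const).measurableSet
  -- `u`, hence `Du`, vanishes on the part of `{φ > s}` that lies outside the support of `ψ`
  have hzero : ∀ᵐ x, x ∈ (E ∩ {x | s < φ x}) ∩ (tsupport ψ)ᶜ → Du x = 0 := by
    refine hu.1.1.ae_eq (hasWeakGradient_zero Set.univ)
      ((hE.inter (isOpen_lt continuous_const hφc)).inter (isClosed_tsupport ψ).isOpen_compl)
      (Set.subset_univ _) (Set.subset_univ _) fun x hx => ?_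
    have h1 : ψ x = 0 := image_eq_zero_of_notMem_tsupport hx.2
    rw [hψ, levelTest, Set.indicator_of_mem hx.1.1] at h1
    exact eq_zero_of_trunc_eq_zero hM
      ((mul_eq_zero.1 h1).resolve_right (levelCutoff_pos hst hx.1.2).ne')
  have lower : ENNReal.ofReal C₀ * ∫⁻ x in E ∩ {x | t ≤ φ x}, ENNReal.ofReal (‖Du x‖ ^ p) ≤
      energy f (E ∩ tsupport ψ) u Du := by
    have h1 : ∫⁻ x in E ∩ {x | t ≤ φ x}, ENNReal.ofReal (‖Du x‖ ^ p) ≤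
        ∫⁻ x in E ∩ tsupport ψ, ENNReal.ofReal (‖Du x‖ ^ p) := by
      rw [← lintegral_indicator (hEm.inter (isClosed_le continuous_const hφc).measurableSet),
        ← lintegral_indicator hts]
      refine lintegral_mono_ae ?_
      filter_upwards [hzero] with x hx
      by_cases h1 : x ∈ E ∩ {x | t ≤ φ x}
      · rw [Set.indicator_of_mem h1]
        by_cases h2 : x ∈ tsupport ψ
        · rw [Set.indicator_of_mem (show x ∈ E ∩ tsupport ψ from ⟨h1.1, h2⟩)]
        · rw [hx ⟨⟨h1.1, hst.trans_le h1.2⟩, h2⟩, norm_zero, Real.zero_rpow (by linarith)]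
          simp
      · rw [Set.indicator_of_notMem h1]
        exact zero_le
    refine (mul_le_mul_right h1 _).trans ?_
    rw [energy, ← lintegral_const_mul' _ _ ENNReal.ofReal_ne_top]
    refine lintegral_mono_ae ((ae_restrict_iff' hts).2 ?_)
    filter_upwards [hbE] with x hx hxt
    rw [← ENNReal.ofReal_mul hC₀.le]
    exact ENNReal.ofReal_le_ofReal (hx hxt.1 _ _).1
  set R1 : Rn N → ℝ≥0∞ := fun x => ENNReal.ofReal (‖Du x‖ ^ p) with hR1
  set R2 : Rn N → ℝ≥0∞ := fun x => ENNReal.ofReal (((1 - truncDeriv M (u x)) * ‖Du x‖) ^ p) with hR2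
  set R3 : Rn N → ℝ≥0∞ :=
    fun x => ENNReal.ofReal ((|trunc M (u x)| * ‖gradient φ x‖) ^ p) with hR3
  have hR1m : AEMeasurable R1 volume := (hDum.norm.aemeasurable.pow_const p).ennreal_ofReal
  have hR2m : AEMeasurable R2 volume :=
    ((((continuous_truncDeriv M).comp_aestronglyMeasurable hum).aemeasurable.const_sub 1).mul
      hDum.norm.aemeasurable |>.pow_const p).ennreal_ofReal
  have upper : energy f (E ∩ tsupport ψ) (fun x => u x - ψ x) (fun x => Du x - Dψ x) ≤
      ENNReal.ofReal C₁ * (ENNReal.ofReal (3 ^ p) * ∫⁻ x in E ∩ {x | s ≤ φ x},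
        ({x | φ x < t}.indicator R1 x + R2 x +
          ENNReal.ofReal ((L / (t - s)) ^ p) * {x | φ x < t}.indicator R3 x)) := by
    rw [← lintegral_const_mul' _ _ ENNReal.ofReal_ne_top,
      ← lintegral_const_mul' _ _ ENNReal.ofReal_ne_top]
    refine le_trans ?_ (lintegral_mono_set (s := E ∩ tsupport ψ) fun x hx => ⟨hx.1, (hsup hx.2).2⟩)
    rw [energy]
    refine lintegral_mono_ae ((ae_restrict_iff' hts).2 ?_)
    filter_upwards [hbE] with x hx hxt
    refine (ENNReal.ofReal_le_ofReal (hx hxt.1 _ _).2).trans ?_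
    rw [ENNReal.ofReal_mul hC₁]
    refine mul_le_mul_right ?_ _
    set η := levelCutoff s t φ x with hη
    have η0 : 0 ≤ η := levelCutoff_nonneg _ _ _ _
    have η1 : η ≤ 1 := levelCutoff_le_one _ _ _ _
    have T0 := truncDeriv_nonneg M (u x)
    have T1 := truncDeriv_le_one M (u x)
    have hD : ‖Du x - Dψ x‖ ≤ (1 - η) * ‖Du x‖ + (1 - truncDeriv M (u x)) * ‖Du x‖ +
        |trunc M (u x)| * ‖gradient (levelCutoff s t φ) x‖ := by
      have e : Du x - Dψ x = (1 - truncDeriv M (u x) * η) • Du x -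
          trunc M (u x) • gradient (levelCutoff s t φ) x := by
        rw [hDψ, levelTestGrad, Set.indicator_of_mem hxt.1, sub_smul, one_smul]
        abel
      rw [e]
      refine (norm_sub_le _ _).trans ?_
      rw [norm_smul, norm_smul, Real.norm_eq_abs, Real.norm_eq_abs]
      refine add_le_add_left ?_ _
      rw [← add_mul]
      refine mul_le_mul_of_nonneg_right ?_ (norm_nonneg _)
      rw [abs_of_nonneg (by nlinarith)]
      nlinarith
    have hI : (‖Du x - Dψ x‖) ^ p ≤ 3 ^ p * (((1 - η) * ‖Du x‖) ^ p +
        ((1 - truncDeriv M (u x)) * ‖Du x‖) ^ p +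
        (|trunc M (u x)| * ‖gradient (levelCutoff s t φ) x‖) ^ p) :=
      (Real.rpow_le_rpow (norm_nonneg _) hD hp0).trans (add_add_rpow_le
        (mul_nonneg (by linarith) (norm_nonneg _)) (mul_nonneg (by linarith) (norm_nonneg _))
        (by positivity) hp0)
    refine (ENNReal.ofReal_le_ofReal hI).trans ?_
    rw [ENNReal.ofReal_mul (by positivity)]
    refine mul_le_mul_right ?_ _
    refine ENNReal.ofReal_add_le.trans (add_le_add (ENNReal.ofReal_add_le.trans
      (add_le_add ?_ le_rfl)) ?_)
    · rcases lt_or_ge (φ x) t with h | h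
      · rw [Set.indicator_of_mem (show x ∈ {x | φ x < t} from h)]
        refine ENNReal.ofReal_le_ofReal (Real.rpow_le_rpow
          (mul_nonneg (by linarith) (norm_nonneg _)) ?_ hp0)
        exact mul_le_of_le_one_left (norm_nonneg _) (by linarith)
      · rw [hη, levelCutoff_eq_one hst h, sub_self, zero_mul, Real.zero_rpow (by linarith)]
        simp
    · rcases lt_or_ge (φ x) t with h | h
      · rw [Set.indicator_of_mem (show x ∈ {x | φ x < t} from h), hR3]
        have h0 : 0 < t - s := by linarith
        rw [← ENNReal.ofReal_mul (by positivity), ← Real.mul_rpow (by positivity) (by positivity)]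
        refine ENNReal.ofReal_le_ofReal (Real.rpow_le_rpow (by positivity) ?_ hp0)
        calc |trunc M (u x)| * ‖gradient (levelCutoff s t φ) x‖
            ≤ |trunc M (u x)| * (L / (t - s) * ‖gradient φ x‖) :=
              mul_le_mul_of_nonneg_left (norm_gradient_levelCutoff_le hL hφ.1 hst x) (abs_nonneg _)
          _ = L / (t - s) * (|trunc M (u x)| * ‖gradient φ x‖) := by ring
      · rw [gradient_levelCutoff_eq_zero_of_le hst h, norm_zero, mul_zero,
          Real.zero_rpow (by linarith)]
        simp
  have split : ∫⁻ x in E ∩ {x | s ≤ φ x},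
        ({x | φ x < t}.indicator R1 x + R2 x +
          ENNReal.ofReal ((L / (t - s)) ^ p) * {x | φ x < t}.indicator R3 x) ≤
      (∫⁻ x in E ∩ {x | s ≤ φ x ∧ φ x < t}, R1 x) + (∫⁻ x in U ∩ E, R2 x) +
        ENNReal.ofReal ((L / (t - s)) ^ p) * ∫⁻ x in E ∩ {x | s ≤ φ x ∧ φ x < t}, R3 x := by
    have hset : {x | φ x < t} ∩ (E ∩ {x | s ≤ φ x}) = E ∩ {x | s ≤ φ x ∧ φ x < t} := by
      ext x
      simp only [Set.mem_inter_iff, Set.mem_ofPred_eq]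
      tauto
    have hm1 : AEMeasurable (fun x => {x | φ x < t}.indicator R1 x)
        (volume.restrict (E ∩ {x | s ≤ φ x})) := hR1m.restrict.indicator hlt
    have hm2 : AEMeasurable (fun x => {x | φ x < t}.indicator R1 x + R2 x)
        (volume.restrict (E ∩ {x | s ≤ φ x})) := hm1.add hR2m.restrict
    rw [lintegral_add_left' hm2, lintegral_add_left' hm1,
      lintegral_const_mul' _ _ ENNReal.ofReal_ne_top, setLIntegral_indicator hlt,
      setLIntegral_indicator hlt, hset]
    refine add_le_add (add_le_add le_rfl (lintegral_mono_set ?_)) le_rfl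
    exact fun x hx => ⟨hφU x (hs.trans_le hx.2), hx.1⟩
  have total := (lower.trans hmin).trans (mul_le_mul_right (upper.trans
    (mul_le_mul_right (mul_le_mul_right split _) _)) _)
  have hne : ENNReal.ofReal C₀ ≠ 0 := by simpa using hC₀
  have hA : ENNReal.ofReal (Q * (C₁ / C₀) * 3 ^ p) = (ENNReal.ofReal C₀)⁻¹ *
      (ENNReal.ofReal Q * (ENNReal.ofReal C₁ * ENNReal.ofReal (3 ^ p))) := by
    rw [show Q * (C₁ / C₀) * 3 ^ p = C₀⁻¹ * (Q * (C₁ * 3 ^ p)) by field_simp,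
      ENNReal.ofReal_mul (by positivity), ENNReal.ofReal_mul hQ, ENNReal.ofReal_mul hC₁,
      ENNReal.ofReal_inv_of_pos hC₀]
  have := mul_le_mul_right total (ENNReal.ofReal C₀)⁻¹
  rw [← mul_assoc, ENNReal.inv_mul_cancel hne ENNReal.ofReal_ne_top, one_mul] at this
  rw [hA]
  simpa only [mul_assoc] using this

/-! ### Summation over a geometric sequence of levels -/

theorem lintegral_norm_rpow_eq {F : Type*} [NormedAddCommGroup F] (μ : Measure (Rn N)) {p : ℝ}
    (hp : 0 < p) (g : Rn N → F) :
    ∫⁻ x, ENNReal.ofReal (‖g x‖ ^ p) ∂μ = eLpNorm g (ENNReal.ofReal p) μ ^ p := by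
  rw [eLpNorm_eq_lintegral_rpow_enorm_toReal (by simpa using hp) ENNReal.ofReal_ne_top,
    ENNReal.toReal_ofReal hp.le, ← ENNReal.rpow_mul, one_div, inv_mul_cancel₀ hp.ne',
    ENNReal.rpow_one]
  refine lintegral_congr fun x => ?_
  rw [← ofReal_norm, ENNReal.ofReal_rpow_of_nonneg (norm_nonneg _) hp.le]

theorem MemW1pLoc.lintegral_gradient_ne_top {p : ℝ} (hp : 0 < p) {u : Rn N → ℝ}
    {Du : Rn N → Rn N} (hu : MemW1pLoc p u Du) {E : Set (Rn N)} (hE : Bornology.IsBounded E) :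
    ∫⁻ x in E, ENNReal.ofReal (‖Du x‖ ^ p) ≠ ⊤ := by
  have h : MemLp Du (ENNReal.ofReal p) (volume.restrict E) :=
    (hu.2 _ hE.isCompact_closure).2.mono_measure (Measure.restrict_mono subset_closure le_rfl)
  rw [lintegral_norm_rpow_eq _ hp]
  exact (ENNReal.rpow_lt_top_of_nonneg hp.le h.2.ne).ne

/-- Absorption: if `C` is at most `X / (2A)`, then `A * C` can be moved to the left-hand side. -/
theorem le_two_mul_of_le_mul_add {A : ℝ} (hA : 0 < A) {X C e : ℝ≥0∞} (hX : X ≠ ⊤)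
    (h1 : X ≤ ENNReal.ofReal A * C + e) (h2 : X + C ≤ ENNReal.ofReal (1 + 1 / (2 * A)) * X) :
    X ≤ 2 * e := by
  rcases eq_or_ne e ⊤ with rfl | he
  · simp
  have hXC : X + C ≠ ⊤ := ne_top_of_le_ne_top (ENNReal.mul_ne_top ENNReal.ofReal_ne_top hX) h2
  have hC : C ≠ ⊤ := ne_top_of_le_ne_top hXC le_add_self
  lift X to NNReal using hX
  lift C to NNReal using hC
  lift e to NNReal using he
  have h1' := ENNReal.toReal_mono (by finiteness) h1
  have h2' := ENNReal.toReal_mono (by finiteness) h2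
  rw [ENNReal.toReal_add (by finiteness) (by finiteness), ENNReal.toReal_mul,
    ENNReal.toReal_ofReal hA.le] at h1'
  rw [ENNReal.toReal_add (by finiteness) (by finiteness), ENNReal.toReal_mul,
    ENNReal.toReal_ofReal (by positivity)] at h2'
  simp only [ENNReal.coe_toReal] at h1' h2'
  have h3 : A * (C : ℝ) ≤ X / 2 := by
    have : (C : ℝ) ≤ 1 / (2 * A) * X := by linarith
    calc A * (C : ℝ) ≤ A * (1 / (2 * A) * X) := mul_le_mul_of_nonneg_left this hA.le
      _ = X / 2 := by field_simp
  have h4 : (X : ℝ) ≤ 2 * e := by linarith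
  exact_mod_cast h4

/-- The energy inequality for smooth `φ`, with the truncations of `φ` at height `Λ` and of `u` at
height `M`. The constant depends on `p`, `Q` and the ratio of the growth constants only. -/
theorem exists_lintegral_test_le (p Q κ : ℝ) (hp : 1 < p) (hQ : 1 ≤ Q) (hκ : 1 ≤ κ) :
    ∃ K : ℝ, 0 < K ∧ ∀ (N : ℕ) (C₀ C₁ : ℝ), 0 < C₀ → 0 < C₁ → C₁ / C₀ = κ →
      ∀ (E U : Set (Rn N)), IsOpen E → Bornology.IsBounded E → IsOpen U →
      ∀ (f : Rn N → ℝ → Rn N → ℝ), IsIntegrand E p C₀ C₁ f →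
      ∀ (u : Rn N → ℝ) (Du : Rn N → Rn N),
        IsQSubminimum E p Q f (closure U ∩ closure E) u Du →
        (∀ᵐ x ∂(volume.restrict (U ∩ E)), 0 ≤ u x) → VanishesOnBoundary E p U u →
      ∀ (φ : Rn N → ℝ), IsTestFunction U φ → ∀ (M Λ : ℝ), 0 < M → 0 < Λ →
        ∫⁻ x in U ∩ E, ENNReal.ofReal (‖Du x‖ ^ p * (min (max (φ x) 0) Λ) ^ p) ≤
          ENNReal.ofReal K * (ENNReal.ofReal (Λ ^ p) *
            (∫⁻ x in U ∩ E, ENNReal.ofReal (((1 - truncDeriv M (u x)) * ‖Du x‖) ^ p)) +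
            ∫⁻ x in U ∩ E, ENNReal.ofReal ((|trunc M (u x)| * ‖gradient φ x‖) ^ p)) := by
  obtain ⟨L, hL0, hL⟩ := exists_abs_deriv_smoothTransition_le
  have hp0 : 0 < p := by linarith
  set A : ℝ := Q * κ * 3 ^ p with hAdef
  have hA : 0 < A := by positivity
  -- the ratio of the weights is chosen such that `A / q = A + 1 / 2`
  set q : ℝ := (1 + 1 / (2 * A))⁻¹ with hqdef
  have hq0 : 0 < q := by positivity
  have hq1 : q < 1 := inv_lt_one_of_one_lt₀ (by linarith [show 0 < 1 / (2 * A) by positivity])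
  set r : ℝ := q ^ p⁻¹ with hrdef
  have hr0 : 0 < r := by positivity
  have hr1 : r < 1 := Real.rpow_lt_one hq0.le hq1 (by positivity)
  have hrp : r ^ p = q := by rw [hrdef, ← Real.rpow_mul hq0.le, inv_mul_cancel₀ hp0.ne',
    Real.rpow_one]
  have h1r : 0 < 1 - r := by linarith
  have h1q : 0 < 1 - q := by linarith
  set K₁ : ℝ := q⁻¹ * (2 * (A * (1 - q)⁻¹)) with hK₁
  set K₂ : ℝ := q⁻¹ * (2 * (A * (L / (1 - r)) ^ p)) with hK₂
  refine ⟨K₁ + K₂, by positivity, ?_⟩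
  intro N C₀ C₁ hC₀ hC₁ hratio E U hE hEb hU f hf u Du hu hupos hu0 φ hφ M Λ hM hΛ
  have hEm := hE.measurableSet
  have hφc := hφ.1.continuous
  have hφU : ∀ x, 0 < φ x → x ∈ U := fun x hx => hφ.2.2 (subset_tsupport φ hx.ne')
  have hDum : AEStronglyMeasurable Du volume := by
    have := hu.1.1.2.1.aestronglyMeasurable
    rwa [Measure.restrict_univ] at this
  set R1 : Rn N → ℝ≥0∞ := fun x => ENNReal.ofReal (‖Du x‖ ^ p) with hR1
  set R3 : Rn N → ℝ≥0∞ :=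
    fun x => ENNReal.ofReal ((|trunc M (u x)| * ‖gradient φ x‖) ^ p) with hR3
  set R := ∫⁻ x in U ∩ E, ENNReal.ofReal (((1 - truncDeriv M (u x)) * ‖Du x‖) ^ p) with hR
  have hR1m : AEMeasurable R1 volume := (hDum.norm.aemeasurable.pow_const p).ennreal_ofReal
  set s : ℕ → ℝ := fun k => Λ * r ^ k with hs
  have hspos : ∀ k, 0 < s k := fun k => by positivity
  have hslt : ∀ k, s (k + 1) < s k := fun k => by
    simp only [hs, pow_succ]
    exact mul_lt_mul_of_pos_left (mul_lt_of_lt_one_right (by positivity) hr1) hΛ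
  have hsanti : Antitone s := antitone_nat_of_succ_le fun k => (hslt k).le
  have hsm : ∀ k, MeasurableSet {x | s k ≤ φ x} := fun k =>
    (isClosed_le continuous_const hφc).measurableSet
  set S : ℕ → Set (Rn N) := fun k => E ∩ {x | s k ≤ φ x} with hS
  set T : ℕ → Set (Rn N) := fun k => E ∩ {x | s (k + 1) ≤ φ x ∧ φ x < s k} with hT
  have hTm : ∀ k, MeasurableSet (T k) := fun k => hEm.inter
    ((hsm (k + 1)).inter (isOpen_lt hφc continuous_const).measurableSet)
  set w : ℝ≥0∞ := ENNReal.ofReal q with hw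
  -- finiteness of the weighted sum
  have hfin : ∫⁻ x in E, R1 x ≠ ⊤ := MemW1pLoc.lintegral_gradient_ne_top hp0 hu.1 hEb
  have hgeom : ∑' k : ℕ, w ^ k = ENNReal.ofReal (1 - q)⁻¹ := by
    rw [ENNReal.tsum_geometric, hw, ENNReal.ofReal_inv_of_pos h1q, ENNReal.ofReal_sub _ hq0.le,
      ENNReal.ofReal_one]
  set X := ∑' k : ℕ, w ^ k * ∫⁻ x in S k, R1 x with hX
  set C := ∑' k : ℕ, w ^ k * ∫⁻ x in T k, R1 x with hC
  have hXfin : X ≠ ⊤ := by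
    have : X ≤ ∑' k : ℕ, w ^ k * ∫⁻ x in E, R1 x :=
      ENNReal.tsum_le_tsum fun k => mul_le_mul_right (lintegral_mono_set Set.inter_subset_left) _
    refine ne_top_of_le_ne_top ?_ this
    rw [ENNReal.tsum_mul_right, hgeom]
    exact ENNReal.mul_ne_top ENNReal.ofReal_ne_top hfin
  set e : ℝ≥0∞ := ENNReal.ofReal A * (ENNReal.ofReal (1 - q)⁻¹ * R +
    ENNReal.ofReal ((L / (Λ * (1 - r))) ^ p) * ∫⁻ x in U ∩ E, R3 x) with he
  have hwr : ∀ k : ℕ, (r ^ k) ^ p = q ^ k := fun k => by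
    rw [← hrp, ← Real.rpow_natCast, ← Real.rpow_natCast, ← Real.rpow_mul hr0.le,
      ← Real.rpow_mul hr0.le, mul_comm]
  have h1 : X ≤ ENNReal.ofReal A * C + e := by
    have step : ∀ k, w ^ k * ∫⁻ x in S k, R1 x ≤
        ENNReal.ofReal A * (w ^ k * ∫⁻ x in T k, R1 x) +
          ENNReal.ofReal A * (w ^ k * R + ENNReal.ofReal ((L / (Λ * (1 - r))) ^ p) *
            ∫⁻ x in T k, R3 x) := by
      intro k
      have h := lintegral_superlevel_le hE hEb hU hp (by linarith) hC₀ hC₁.le hL0.le hL hf hu hupos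
        hu0 hM (hspos (k + 1)) (hslt k) hφ
      rw [hratio] at h
      have hB : w ^ k * ENNReal.ofReal ((L / (s k - s (k + 1))) ^ p) =
          ENNReal.ofReal ((L / (Λ * (1 - r))) ^ p) := by
        have hd : s k - s (k + 1) = Λ * (1 - r) * r ^ k := by simp only [hs, pow_succ]; ring
        rw [hw, ← ENNReal.ofReal_pow hq0.le, ← ENNReal.ofReal_mul (by positivity), hd, ← hwr,
          ← Real.mul_rpow (by positivity) (by positivity)]
        congr 2
        field_simp
      refine (mul_le_mul_right h (w ^ k)).trans (le_of_eq ?_)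
      rw [← hB]
      ring
    refine (ENNReal.tsum_le_tsum step).trans ?_
    rw [ENNReal.tsum_add, ENNReal.tsum_mul_left, ENNReal.tsum_mul_left, ENNReal.tsum_add,
      ENNReal.tsum_mul_left, ENNReal.tsum_mul_right, hgeom]
    refine add_le_add le_rfl (mul_le_mul_right (add_le_add le_rfl (mul_le_mul_right ?_ _)) _)
    rw [← lintegral_iUnion hTm]
    · refine lintegral_mono_set (Set.iUnion_subset fun k x hx => ?_)
      exact ⟨hφU x ((hspos (k + 1)).trans_le hx.2.1), hx.1⟩
    · have : ∀ i j, i < j → Disjoint (T i) (T j) := fun i j hij =>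
        Set.disjoint_left.2 fun x hi hj =>
          absurd (hj.2.2.trans_le ((hsanti (Nat.succ_le_of_lt hij)).trans hi.2.1)) (lt_irrefl _)
      intro i j hij
      rcases lt_or_gt_of_ne hij with h | h
      · exact this i j h
      · exact (this j i h).symm
  have h2 : X + C ≤ ENNReal.ofReal (1 + 1 / (2 * A)) * X := by
    have hwinv : ENNReal.ofReal (1 + 1 / (2 * A)) * w = 1 := by
      rw [hw, ← ENNReal.ofReal_mul (by positivity), hqdef, mul_inv_cancel₀ (by positivity),
        ENNReal.ofReal_one]
    have step : ∀ k, w ^ k * (∫⁻ x in S k, R1 x) + w ^ k * (∫⁻ x in T k, R1 x) =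
        ENNReal.ofReal (1 + 1 / (2 * A)) * (w ^ (k + 1) * ∫⁻ x in S (k + 1), R1 x) := by
      intro k
      have hunion : S (k + 1) = S k ∪ T k := by
        ext x
        simp only [hS, hT, Set.mem_union, Set.mem_inter_iff, Set.mem_ofPred_eq, ← and_or_left]
        refine and_congr_right fun _ => ⟨fun h => ?_, fun h => ?_⟩
        · rcases le_or_gt (s k) (φ x) with h' | h'
          · exact Or.inl h'
          · exact Or.inr ⟨h, h'⟩
        · rcases h with h | h
          · exact (hslt k).le.trans h
          · exact h.1
      have hdisj : Disjoint (S k) (T k) :=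
        Set.disjoint_left.2 fun x h h' => absurd (h'.2.2.trans_le h.2) (lt_irrefl _)
      rw [hunion, lintegral_union (hTm k) hdisj, ← mul_assoc, pow_succ, mul_comm (w ^ k) w,
        ← mul_assoc, hwinv, one_mul, mul_add]
    rw [hX, hC, ← ENNReal.tsum_add]
    simp_rw [step]
    rw [ENNReal.tsum_mul_left]
    exact mul_le_mul_right (ENNReal.tsum_comp_le_tsum_of_injective (add_left_injective 1) _) _
  have hXe : X ≤ 2 * e := le_two_mul_of_le_mul_add hA hXfin h1 h2
  have hlow : ∫⁻ x in U ∩ E, ENNReal.ofReal (‖Du x‖ ^ p * (min (max (φ x) 0) Λ) ^ p) ≤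
      ENNReal.ofReal (Λ ^ p * q⁻¹) * X := by
    have point : ∀ x, ENNReal.ofReal (‖Du x‖ ^ p * (min (max (φ x) 0) Λ) ^ p) ≤
        ENNReal.ofReal (Λ ^ p * q⁻¹) * ∑' k : ℕ, w ^ k * {x | s k ≤ φ x}.indicator R1 x := by
      intro x
      have hm0 : 0 ≤ min (max (φ x) 0) Λ := le_min (le_max_right _ _) hΛ.le
      rcases hm0.eq_or_lt with hm | hm
      · rw [← hm, Real.zero_rpow hp0.ne', mul_zero]
        simp
      set m := min (max (φ x) 0) Λ with hmdef
      have hmφ : m ≤ φ x := by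
        have h : m ≤ max (φ x) 0 := min_le_left _ _
        rcases le_or_gt (φ x) 0 with h' | h'
        · rw [max_eq_right h'] at h
          linarith
        · rwa [max_eq_left h'.le] at h
      obtain ⟨n, hn1, hn2⟩ := exists_nat_pow_near_of_lt_one (x := m / Λ) (by positivity)
        ((div_le_one hΛ).2 (min_le_right _ _)) hr0 hr1
      have hsn : s (n + 1) ≤ φ x := by
        rw [lt_div_iff₀ hΛ] at hn1
        simp only [hs]
        linarith
      rw [div_le_iff₀ hΛ] at hn2
      refine le_trans ?_ (mul_le_mul_right (ENNReal.le_tsum (n + 1)) _)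
      rw [Set.indicator_of_mem (show x ∈ {x | s (n + 1) ≤ φ x} from hsn), hw,
        ← ENNReal.ofReal_pow hq0.le, ← mul_assoc, ← ENNReal.ofReal_mul (by positivity), hR1,
        ← ENNReal.ofReal_mul (by positivity)]
      refine ENNReal.ofReal_le_ofReal ?_
      rw [mul_comm]
      refine mul_le_mul_of_nonneg_right ?_ (by positivity)
      calc m ^ p ≤ (r ^ n * Λ) ^ p := Real.rpow_le_rpow hm.le hn2 hp0.le
        _ = Λ ^ p * q⁻¹ * q ^ (n + 1) := by
          rw [Real.mul_rpow (by positivity) hΛ.le, hwr, pow_succ]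
          field_simp
    refine (lintegral_mono point).trans ?_
    rw [lintegral_const_mul' _ _ ENNReal.ofReal_ne_top, lintegral_tsum fun k =>
      ((hR1m.indicator (hsm k)).const_mul _).restrict]
    refine mul_le_mul_right (ENNReal.tsum_le_tsum fun k => ?_) _
    rw [lintegral_const_mul' _ _ (ENNReal.pow_ne_top ENNReal.ofReal_ne_top),
      setLIntegral_indicator (hsm k)]
    exact mul_le_mul_right (lintegral_mono_set (t := S k) fun x hx => ⟨hx.2.2, hx.1⟩) _
  refine (hlow.trans (mul_le_mul_right hXe _)).trans ?_
  have hK1 : ENNReal.ofReal (Λ ^ p * q⁻¹) * (2 * (ENNReal.ofReal A * ENNReal.ofReal (1 - q)⁻¹)) =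
      ENNReal.ofReal K₁ * ENNReal.ofReal (Λ ^ p) := by
    rw [← ENNReal.ofReal_mul (by positivity), ← ENNReal.ofReal_ofNat,
      ← ENNReal.ofReal_mul (by positivity), ← ENNReal.ofReal_mul (by positivity),
      ← ENNReal.ofReal_mul (by positivity)]
    congr 1
    rw [hK₁]
    ring
  have hK2 : ENNReal.ofReal (Λ ^ p * q⁻¹) *
      (2 * (ENNReal.ofReal A * ENNReal.ofReal ((L / (Λ * (1 - r))) ^ p))) = ENNReal.ofReal K₂ := by
    rw [← ENNReal.ofReal_mul (by positivity), ← ENNReal.ofReal_ofNat,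
      ← ENNReal.ofReal_mul (by positivity), ← ENNReal.ofReal_mul (by positivity)]
    congr 1
    have : (L / (1 - r)) ^ p = Λ ^ p * (L / (Λ * (1 - r))) ^ p := by
      rw [← Real.mul_rpow (by positivity) (by positivity)]
      congr 1
      field_simp
    rw [hK₂, this]
    ring
  calc ENNReal.ofReal (Λ ^ p * q⁻¹) * (2 * e)
      = ENNReal.ofReal (Λ ^ p * q⁻¹) * (2 * (ENNReal.ofReal A * ENNReal.ofReal (1 - q)⁻¹)) * R +
        ENNReal.ofReal (Λ ^ p * q⁻¹) *
          (2 * (ENNReal.ofReal A * ENNReal.ofReal ((L / (Λ * (1 - r))) ^ p))) *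
            ∫⁻ x in U ∩ E, R3 x := by rw [he]; ring
    _ = ENNReal.ofReal K₁ * (ENNReal.ofReal (Λ ^ p) * R) +
        ENNReal.ofReal K₂ * ∫⁻ x in U ∩ E, R3 x := by rw [hK1, hK2, mul_assoc]
    _ ≤ ENNReal.ofReal (K₁ + K₂) * (ENNReal.ofReal (Λ ^ p) * R) +
        ENNReal.ofReal (K₁ + K₂) * ∫⁻ x in U ∩ E, R3 x := by
      have k1 : 0 < K₁ := by positivity
      have k2 : 0 < K₂ := by positivity
      gcongr <;> linarith
    _ = _ := by rw [mul_add]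

/-! ### Passage to the limit -/

/-- Fatou's lemma, with bounds that converge. -/
theorem lintegral_le_of_tendsto {μ : Measure (Rn N)} {F : ℕ → Rn N → ℝ≥0∞} {G : Rn N → ℝ≥0∞}
    {b : ℕ → ℝ≥0∞} {B : ℝ≥0∞} (hF : ∀ n, AEMeasurable (F n) μ)
    (hlim : ∀ᵐ x ∂μ, Tendsto (fun n => F n x) atTop (𝓝 (G x)))
    (hb : ∀ n, ∫⁻ x, F n x ∂μ ≤ b n) (hB : Tendsto b atTop (𝓝 B)) : ∫⁻ x, G x ∂μ ≤ B :=
  calc ∫⁻ x, G x ∂μ = ∫⁻ x, liminf (fun n => F n x) atTop ∂μ :=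
        lintegral_congr_ae (hlim.mono fun _ hx => hx.liminf_eq.symm)
    _ ≤ liminf (fun n => ∫⁻ x, F n x ∂μ) atTop := lintegral_liminf_le' hF
    _ ≤ liminf b atTop := liminf_le_liminf (Eventually.of_forall hb)
    _ = B := hB.liminf_eq

theorem tendsto_truncation_error {p : ℝ} (hp : 0 < p) {u : Rn N → ℝ} {Du : Rn N → Rn N}
    (hu : MemW1pLoc p u Du) {A : Set (Rn N)} (hA : Bornology.IsBounded A) :
    Tendsto (fun n : ℕ => ∫⁻ x in A,
      ENNReal.ofReal (((1 - truncDeriv ((n : ℝ) + 1) (u x)) * ‖Du x‖) ^ p)) atTop (𝓝 0) := by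
  have hDum : AEStronglyMeasurable Du volume := by
    have := hu.1.2.1.aestronglyMeasurable
    rwa [Measure.restrict_univ] at this
  have hum : AEStronglyMeasurable u volume := by
    have := hu.1.1.aestronglyMeasurable
    rwa [Measure.restrict_univ] at this
  have h := tendsto_lintegral_of_dominated_convergence' (μ := volume.restrict A)
    (F := fun (n : ℕ) x =>
      ENNReal.ofReal (((1 - truncDeriv ((n : ℝ) + 1) (u x)) * ‖Du x‖) ^ p)) (f := fun _ => 0)
    (fun x => ENNReal.ofReal (‖Du x‖ ^ p))
    (fun n => ((((continuous_truncDeriv _).comp_aestronglyMeasurable hum).aemeasurable.const_sub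
      1).mul hDum.norm.aemeasurable |>.pow_const p).ennreal_ofReal.restrict)
    (fun n => Eventually.of_forall fun x => ?_) (hu.lintegral_gradient_ne_top hp hA)
    (Eventually.of_forall fun x => ?_)
  · simpa using h
  · have h1 := truncDeriv_le_one ((n : ℝ) + 1) (u x)
    refine ENNReal.ofReal_le_ofReal (Real.rpow_le_rpow
      (mul_nonneg (by linarith) (norm_nonneg _)) (mul_le_of_le_one_left (norm_nonneg _) ?_) hp.le)
    linarith [truncDeriv_nonneg ((n : ℝ) + 1) (u x)]
  · have h1 := (((tendsto_truncDeriv (u x)).const_sub 1).mul_const ‖Du x‖).rpow_const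
      (Or.inr hp.le)
    have h2 := ENNReal.tendsto_ofReal h1
    simpa [Real.zero_rpow hp.ne'] using h2

end QMin

theorem proposition2p1 (N : ℕ) (p Q κ : ℝ) (hp : 1 < p) (hQ : 1 ≤ Q) :
    ∃ γ : ℝ, 0 < γ ∧
      ∀ (C₀ C₁ : ℝ), 0 < C₀ → C₀ ≤ C₁ → C₁ / C₀ = κ →
      ∀ (E : Set (QMin.Rn N)), IsOpen E → Bornology.IsBounded E →
      ∀ (f : QMin.Rn N → ℝ → QMin.Rn N → ℝ), QMin.IsIntegrand E p C₀ C₁ f →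
      ∀ (y : QMin.Rn N) (ρ : ℝ), y ∈ frontier E → 0 < ρ →
      ∀ (u : QMin.Rn N → ℝ) (Du : QMin.Rn N → QMin.Rn N),
        QMin.IsQSubminimum E p Q f (closure (Metric.ball y ρ) ∩ closure E) u Du →
        (∀ᵐ x ∂(volume.restrict (Metric.ball y ρ ∩ E)), 0 ≤ u x) →
        QMin.VanishesOnBoundary E p (Metric.ball y ρ) u →
      ∀ (φ : QMin.Rn N → ℝ) (Dφ : QMin.Rn N → QMin.Rn N),
        QMin.MemW1pZero (Metric.ball y ρ) p φ Dφ →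
        (∀ᵐ x ∂(volume.restrict (Metric.ball y ρ)), 0 ≤ φ x) →
        ∫⁻ x in Metric.ball y ρ ∩ E, ENNReal.ofReal (‖Du x‖ ^ p * |φ x| ^ p) ≤
          ENNReal.ofReal γ *
            ∫⁻ x in Metric.ball y ρ ∩ E, ENNReal.ofReal (u x ^ p * ‖Dφ x‖ ^ p) := by
  open QMin in
  by_cases hκ : κ < 1
  · refine ⟨1, one_pos, fun C₀ C₁ h0 h1 h2 => ?_⟩
    have : 1 ≤ C₁ / C₀ := (one_le_div h0).2 h1
    linarith
  obtain ⟨K, hK, hmain⟩ := exists_lintegral_test_le p Q κ hp hQ (not_lt.1 hκ)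
  refine ⟨K * 3 ^ p, by positivity, ?_⟩
  intro C₀ C₁ hC₀ hC₀₁ hratio E hE hEb f hf y ρ _ _ u Du hu hupos hu0 φ Dφ hφ hφ0
  have hp0 : 0 < p := by linarith
  set U := Metric.ball y ρ with hUdef
  have hUE : volume.restrict (U ∩ E) ≤ volume.restrict U :=
    Measure.restrict_mono Set.inter_subset_left le_rfl
  have hDum : AEStronglyMeasurable Du volume := by
    have := hu.1.1.2.1.aestronglyMeasurable
    rwa [Measure.restrict_univ] at this
  have hum : AEStronglyMeasurable u volume := by
    have := hu.1.1.1.aestronglyMeasurable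
    rwa [Measure.restrict_univ] at this
  obtain ⟨⟨-, hφp, hDφp⟩, ψ, hψ, hψφ, hψD⟩ := hφ
  obtain ⟨ns, hns, hae⟩ := (tendstoInMeasure_of_tendsto_eLpNorm (by simpa using hp0)
    (fun n => ((hψ n).1.continuous.aestronglyMeasurable)) hφp.1 hψφ).exists_seq_tendsto_ae
  -- `φ` is the limit of the test functions, for fixed truncation heights
  have step1 : ∀ (M Λ : ℝ), 0 < M → 0 < Λ →
      ∫⁻ x in U ∩ E, ENNReal.ofReal (‖Du x‖ ^ p * (min (max (φ x) 0) Λ) ^ p) ≤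
        ENNReal.ofReal K * (ENNReal.ofReal (Λ ^ p) *
          (∫⁻ x in U ∩ E, ENNReal.ofReal (((1 - truncDeriv M (u x)) * ‖Du x‖) ^ p)) +
          ENNReal.ofReal (3 ^ p) *
            ∫⁻ x in U ∩ E, ENNReal.ofReal ((|trunc M (u x)| * ‖Dφ x‖) ^ p)) := by
    intro M Λ hM hΛ
    set R := ∫⁻ x in U ∩ E, ENNReal.ofReal (((1 - truncDeriv M (u x)) * ‖Du x‖) ^ p)
    set I := ∫⁻ x in U ∩ E, ENNReal.ofReal ((|trunc M (u x)| * ‖Dφ x‖) ^ p)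
    set d : ℕ → ℝ≥0∞ := fun n =>
      ∫⁻ x in U, ENNReal.ofReal (‖gradient (ψ (ns n)) x - Dφ x‖ ^ p) with hd
    have hd0 : Tendsto d atTop (𝓝 0) := by
      have h := (hψD.comp hns.tendsto_atTop).ennrpow_const p
      rw [ENNReal.zero_rpow_of_pos hp0] at h
      refine h.congr fun n => ?_
      rw [hd]
      exact (lintegral_norm_rpow_eq _ hp0 _).symm
    have hbound : ∀ n, ∫⁻ x in U ∩ E,
        ENNReal.ofReal ((|trunc M (u x)| * ‖gradient (ψ (ns n)) x‖) ^ p) ≤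
          ENNReal.ofReal (3 ^ p) * (I + ENNReal.ofReal ((2 * M) ^ p) * d n) := by
      intro n
      have hpt : ∀ x, ENNReal.ofReal ((|trunc M (u x)| * ‖gradient (ψ (ns n)) x‖) ^ p) ≤
          ENNReal.ofReal (3 ^ p) * (ENNReal.ofReal ((|trunc M (u x)| * ‖Dφ x‖) ^ p) +
            ENNReal.ofReal ((2 * M) ^ p) *
              ENNReal.ofReal (‖gradient (ψ (ns n)) x - Dφ x‖ ^ p)) := by
        intro x
        rw [← ENNReal.ofReal_mul (by positivity), ← ENNReal.ofReal_add (by positivity)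
          (by positivity), ← ENNReal.ofReal_mul (by positivity),
          ← Real.mul_rpow (by positivity) (by positivity)]
        refine ENNReal.ofReal_le_ofReal ?_
        have h := add_add_rpow_le (a := |trunc M (u x)| * ‖Dφ x‖)
          (b := 2 * M * ‖gradient (ψ (ns n)) x - Dφ x‖) (c := 0) (by positivity) (by positivity)
          le_rfl hp0.le
        rw [Real.zero_rpow hp0.ne', add_zero, add_zero] at h
        refine (Real.rpow_le_rpow (by positivity) ?_ hp0.le).trans h
        calc |trunc M (u x)| * ‖gradient (ψ (ns n)) x‖
            ≤ |trunc M (u x)| * (‖Dφ x‖ + ‖gradient (ψ (ns n)) x - Dφ x‖) :=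
              mul_le_mul_of_nonneg_left (norm_le_insert' _ _) (abs_nonneg _)
          _ ≤ _ := by
              rw [mul_add]
              gcongr
              exact abs_trunc_le hM _
      refine (lintegral_mono hpt).trans ?_
      rw [lintegral_const_mul' _ _ ENNReal.ofReal_ne_top, lintegral_add_left',
        lintegral_const_mul' _ _ ENNReal.ofReal_ne_top]
      · gcongr
        exact lintegral_mono_set Set.inter_subset_left
      · exact (((contDiff_trunc M).continuous.comp_aestronglyMeasurable
          hum).norm.aemeasurable.restrict.mul
          (hDφp.1.mono_measure hUE).norm.aemeasurable |>.pow_const p).ennreal_ofReal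
    refine lintegral_le_of_tendsto
      (F := fun n x => ENNReal.ofReal (‖Du x‖ ^ p * (min (max (ψ (ns n) x) 0) Λ) ^ p))
      (b := fun n => ENNReal.ofReal K * (ENNReal.ofReal (Λ ^ p) * R +
        ENNReal.ofReal (3 ^ p) * (I + ENNReal.ofReal ((2 * M) ^ p) * d n)))
      (fun n => ?_) ?_ (fun n => ?_) ?_
    · refine ((hDum.norm.aemeasurable.restrict.pow_const p).mul ?_).ennreal_ofReal
      exact (((hψ (ns n)).1.continuous.max continuous_const).min
        continuous_const).aemeasurable.pow_const p
    · filter_upwards [ae_mono hUE hae] with x hx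
      exact ENNReal.tendsto_ofReal ((((hx.max tendsto_const_nhds).min
        tendsto_const_nhds).rpow_const (Or.inr hp0.le)).const_mul _)
    · refine (hmain N C₀ C₁ hC₀ (hC₀.trans_le hC₀₁) hratio E U hE hEb Metric.isOpen_ball f hf u Du
        hu hupos hu0 (ψ (ns n)) (hψ (ns n)) M Λ hM hΛ).trans ?_
      gcongr
      exact hbound n
    · have t1 := ENNReal.Tendsto.const_mul (a := ENNReal.ofReal ((2 * M) ^ p)) hd0
        (Or.inr ENNReal.ofReal_ne_top)
      have t2 := ENNReal.Tendsto.const_mul (a := ENNReal.ofReal (3 ^ p))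
        (t1.const_add I) (Or.inr ENNReal.ofReal_ne_top)
      have t3 := ENNReal.Tendsto.const_mul (a := ENNReal.ofReal K)
        (t2.const_add (ENNReal.ofReal (Λ ^ p) * R)) (Or.inr ENNReal.ofReal_ne_top)
      simpa using t3
  -- the truncation of `u` is removed
  have step2 : ∀ Λ : ℝ, 0 < Λ →
      ∫⁻ x in U ∩ E, ENNReal.ofReal (‖Du x‖ ^ p * (min (max (φ x) 0) Λ) ^ p) ≤
        ENNReal.ofReal (K * 3 ^ p) *
          ∫⁻ x in U ∩ E, ENNReal.ofReal (u x ^ p * ‖Dφ x‖ ^ p) := by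
    intro Λ hΛ
    have t1 := ENNReal.Tendsto.const_mul (a := ENNReal.ofReal (Λ ^ p))
      (tendsto_truncation_error hp0 hu.1 (hEb.subset (Set.inter_subset_right (s := U))))
      (Or.inr ENNReal.ofReal_ne_top)
    have t2 := ENNReal.Tendsto.const_mul (a := ENNReal.ofReal K)
      (t1.add_const (ENNReal.ofReal (3 ^ p) *
        ∫⁻ x in U ∩ E, ENNReal.ofReal (u x ^ p * ‖Dφ x‖ ^ p))) (Or.inr ENNReal.ofReal_ne_top)
    rw [mul_zero, zero_add, ← mul_assoc, ← ENNReal.ofReal_mul hK.le] at t2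
    refine ge_of_tendsto t2 (Eventually.of_forall fun n => ?_)
    refine (step1 ((n : ℝ) + 1) Λ (by positivity) hΛ).trans ?_
    refine mul_le_mul_right (add_le_add le_rfl (mul_le_mul_right (lintegral_mono_ae ?_) _)) _
    filter_upwards [hupos] with x hx
    rw [← Real.mul_rpow hx (norm_nonneg _), abs_of_nonneg (trunc_nonneg (by positivity) hx)]
    have := trunc_nonneg (M := (n : ℝ) + 1) (by positivity) hx
    gcongr
    exact trunc_le (by positivity) hx
  -- the truncation of `φ` is removed
  refine lintegral_le_of_tendsto
    (F := fun (n : ℕ) x =>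
      ENNReal.ofReal (‖Du x‖ ^ p * (min (max (φ x) 0) ((n : ℝ) + 1)) ^ p))
    (fun n => ?_) ?_ (fun n => step2 ((n : ℝ) + 1) (by positivity)) tendsto_const_nhds
  · refine ((hDum.norm.aemeasurable.restrict.pow_const p).mul ?_).ennreal_ofReal
    exact (((hφp.1.mono_measure hUE).aemeasurable.max aemeasurable_const).min
      aemeasurable_const).pow_const p
  · filter_upwards [ae_mono hUE hφ0] with x hx
    refine tendsto_const_nhds.congr' ?_
    filter_upwards [eventually_ge_atTop ⌈φ x⌉₊] with n hn
    have : φ x ≤ n := Nat.ceil_le.1 hn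
    rw [max_eq_left hx, min_eq_left (by linarith), abs_of_nonneg hx]
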